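/- Consider synchronous distributed algorithms in the $\mathcal{CONGEST}$ model. The network is a finite connected simple graph $G=(V,E)$ with $|V|\ge 2$. Every vertex is a processor with unbounded local memory and computational power and a private supply of independent fair coins. Vertices have distinct IDs of $O(\log|V|)$ bits, and one vertex is marked as the leader. Initially a vertex knows only its own ID, the IDs of its neighbours, and whether it is the leader. In each round every vertex performs a local computation and may send one message to each of its neighbours, which is received at the start of the next round. Every message must have $O(\log|V|)$ bits. Let $\mathcal{D}$ be the diameter and $\Delta$ the maximum degree of $G$. A vertex $v$ is a cut vertex if $G\setminus\{v\}$ is disconnected. There is a randomized distributed algorithm with the following properties. On every such network, whatever the outcomes of the coin flips, all vertices halt within $O(\mathcal{D}+\Delta/\log|V|)$ rounds, at most $O\bigl(|E|\,(1+\Delta/\log|V|)\bigr)$ messages are sent in total, and each message has $O(\log|V|)$ bits. When a vertex halts it outputs a bit, and with probability at least $1-1/|V|$ the outputs of all vertices are simultaneously correct, i.e. every vertex states correctly whether it is a cut vertex of $G$. The algorithm does not depend on the network, and the implied constants depend only on the constant in the bound on the ID length. -/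

import Mathlib

/-- A message is a finite bit string; its size is its length. The empty string is a message. -/
abbrev Message : Type := List Bool

/-- What a vertex receives from (or sends to) its neighbours in one round, addressed by their IDs:
at most one message for each ID. -/
abbrev Mailbox : Type := ℕ → Option Message

/-- A (randomized, synchronous) distributed algorithm: the program that every vertex runs. Local
memory and local computational power are unbounded, as usual in this model.
A vertex is told its own ID, the set of IDs of its neighbours, and whether it is the leader, and
nothing else; in particular not the number of vertices. -/
structure DistributedAlgorithm where
  /-- Contents of the local memory of a vertex. -/
  State : Type
  /-- Initial state, from own ID, IDs of the neighbours, and the leader flag. -/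
  start : ℕ → Finset ℕ → Bool → State
  /-- The number of private fair coins a vertex flips in a round, given its state and the messages
  it received at the start of the round. -/
  coins : State → Mailbox → ℕ
  /-- The local computation of a round, from the state, the received messages, and the results of
  the coin flips: the new state, and the messages to be sent, addressed by neighbour ID. -/
  step : (s : State) → (inbox : Mailbox) → (Fin (coins s inbox) → Bool) → State × Mailbox
  /-- `none` while the vertex is running; `some b` once it has halted with local output `b`. -/
  output : State → Option Bool

namespace DistributedAlgorithm

/-- A global configuration at the end of a round. -/
structure Configuration (V S : Type*) where
  /-- the local state of each vertex -/
  state : V → S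
  /-- `sent u w` is the message, if any, sent by `u` to `w` in the round just finished -/
  sent : V → V → Option Message

/-- The results of all potential coin flips: `ω (v, t, i)` is the `i`-th coin of vertex `v` in
round `t`. -/
abbrev Coins (V : Type*) : Type _ := V × ℕ × ℕ → Bool

/-- Independent fair coins. The state of the network after any fixed number of rounds depends on
finitely many of them. -/
noncomputable def coinMeasure (V : Type*) : MeasureTheory.Measure (Coins V) :=
  MeasureTheory.Measure.infinitePi fun _ => (PMF.uniformOfFintype Bool).toMeasure

variable {V : Type*} [Fintype V] [DecidableEq V]

/-- The messages received by `v` at the start of a round, labelled with the IDs of the senders. -/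
noncomputable def inbox {S : Type*} (ident : V → ℕ) (K : Configuration V S) (v : V) : Mailbox :=
  Function.extend ident (fun u => K.sent u v) (fun _ => none)

/-- What vertex `v` does in round `t`. A vertex that has halted keeps its state for ever and sends
nothing. -/
noncomputable def act (A : DistributedAlgorithm) (ident : V → ℕ) (ω : Coins V) (t : ℕ)
    (K : Configuration V A.State) (v : V) : A.State × Mailbox :=
  if (A.output (K.state v)).isSome then (K.state v, fun _ => none)
  else A.step (K.state v) (inbox ident K v) (fun i => ω (v, t, i))

/-- The execution on the network `G` with IDs `ident`, leader `r` and coins `ω`: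
the configuration after `t` rounds. Messages travel along edges of `G` only. -/
noncomputable def run (A : DistributedAlgorithm) (G : SimpleGraph V) [DecidableRel G.Adj]
    (ident : V → ℕ) (r : V) (ω : Coins V) : ℕ → Configuration V A.State
  | 0 =>
    { state := fun v => A.start (ident v) ((G.neighborFinset v).image ident) (decide (v = r))
      sent := fun _ _ => none }
  | t + 1 =>
    { state := fun v => (act A ident ω t (run A G ident r ω t) v).1
      sent := fun u w =>
        if G.Adj u w then (act A ident ω t (run A G ident r ω t) u).2 (ident w) else none }

/-- After `T` rounds every vertex has halted. -/
def HaltsWithin (A : DistributedAlgorithm) (G : SimpleGraph V) [DecidableRel G.Adj]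
    (ident : V → ℕ) (r : V) (ω : Coins V) (T : ℕ) : Prop :=
  ∀ v, (A.output ((A.run G ident r ω T).state v)).isSome

/-- The number of messages sent in the first `T` rounds. -/
noncomputable def messageCount (A : DistributedAlgorithm) (G : SimpleGraph V) [DecidableRel G.Adj]
    (ident : V → ℕ) (r : V) (ω : Coins V) (T : ℕ) : ℕ :=
  ∑ t ∈ Finset.range T,
    (Finset.univ.filter fun p : V × V =>
      ((A.run G ident r ω (t + 1)).sent p.1 p.2).isSome).card

/-- Every message ever sent has at most `B` bits. -/
def MessagesBoundedBy (A : DistributedAlgorithm) (G : SimpleGraph V) [DecidableRel G.Adj]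
    (ident : V → ℕ) (r : V) (ω : Coins V) (B : ℝ) : Prop :=
  ∀ (t : ℕ) (u w : V) (m : Message), (A.run G ident r ω t).sent u w = some m → (m.length : ℝ) ≤ B

end DistributedAlgorithm

/-- `v` is a cut vertex of `G`: deleting it leaves a disconnected graph, that is, two remaining
vertices are not joined by a path that avoids `v`. -/
def IsCutVertex {V : Type*} (G : SimpleGraph V) (v : V) : Prop :=
  ¬ (G.induce {v}ᶜ).Preconnected

/-- After `T` rounds every vertex has halted, with a local output that says correctly whether it is
a cut vertex. -/
def DistributedAlgorithm.FindsCutVertices {V : Type*} [Fintype V] [DecidableEq V]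
    (A : DistributedAlgorithm) (G : SimpleGraph V) [DecidableRel G.Adj]
    (ident : V → ℕ) (r : V) (ω : DistributedAlgorithm.Coins V) (T : ℕ) : Prop :=
  ∀ v, ∃ b : Bool, A.output ((A.run G ident r ω T).state v) = some b ∧
    (b = true ↔ IsCutVertex G v)

/-! Work over the field with two elements, realised as `Bool`. A circulation labels the edges so
that the labels at every vertex sum to zero; its sum over any edge cut is then zero. If `v` is a cut
vertex, the edges from `v` into one component of the rest form a cut, so every circulation sums to
zero over them (`exists_sum_flow_eq_zero`). If `v` is not a cut vertex, no proper nonempty set of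
edges at `v` is a cut, and the sum of a random circulation over it is a fair bit
(`exists_sum_flow_eq_sum_free`). With `b` independent circulations a given set misleads with
probability at most `2⁻ᵇ`. A union bound over at most `2 ^ Δ` sets at each of `n ≤ 2 ^ L` vertices
gives error at most `1 / n` once `b ≥ Δ + 2 * L` (`measureReal_flow_detects`).

A random circulation comes from a breadth-first tree: non-tree edges get fair coins, and
conservation then determines the tree edges from the leaves upwards.

To implement this, a flood from the leader reveals the levels, an echo collects the maximal
identifier size `w` and the maximal degree, and the leader broadcasts both. No vertex knows `n`, but
`w` can replace its logarithm. The bits of an edge are cut into chunks of `w` bits, about `Δ / w` of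
them, and pipelined up the tree, so depth and number of chunks add instead of multiplying. Each
vertex finally tests all subsets of its edges by local brute force.

For correctness of the protocol, `mail` and `view` give the whole execution in closed form. A vertex
with the predicted history sends the predicted messages (`outbox_eq`), and induction on rounds gives
`run_eq`. -/

/-- A network: a finite connected graph with distinct identifiers and a distinguished leader. -/
structure Network (V : Type*) [Fintype V] [DecidableEq V] where
  graph : SimpleGraph V
  decAdj : DecidableRel graph.Adj
  ident : V → ℕ
  root : V
  connected : graph.Connected
  two_le_card : 2 ≤ Fintype.card V
  ident_injective : Function.Injective ident

attribute [instance] Network.decAdj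

/-! ### Breadth-first tree and ownership of edges -/

namespace Network

variable {V : Type*} [Fintype V] [DecidableEq V] (N : Network V)

/-- The level of a vertex: its distance from the leader. -/
noncomputable def lev (v : V) : ℕ := N.graph.dist N.root v

@[simp] lemma lev_root : N.lev N.root = 0 := SimpleGraph.dist_self

lemma lev_eq_zero {v : V} : N.lev v = 0 ↔ v = N.root := by
  rw [lev, N.connected.dist_eq_zero_iff, eq_comm]

lemma lev_le_of_adj {u w : V} (h : N.graph.Adj u w) : N.lev w ≤ N.lev u + 1 := by
  have := N.connected.dist_triangle (u := N.root) (v := u) (w := w)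
  rwa [SimpleGraph.dist_eq_one_iff_adj.2 h] at this

lemma exists_adj_dist_succ {u v : V} (h : u ≠ v) :
    ∃ w, N.graph.Adj u w ∧ N.graph.dist w v + 1 = N.graph.dist u v := by
  obtain ⟨p, hp⟩ := N.connected.exists_walk_length_eq_dist u v
  cases p with
  | nil => exact absurd rfl h
  | @cons _ w _ ha q =>
    refine ⟨w, ha, ?_⟩
    have h1 := SimpleGraph.dist_le q
    have h2 := N.connected.dist_triangle (u := u) (v := w) (w := v)
    rw [SimpleGraph.dist_eq_one_iff_adj.2 ha] at h2
    rw [SimpleGraph.Walk.length_cons] at hp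
    omega

lemma exists_upper {v : V} (h : v ≠ N.root) :
    ∃ u, N.graph.Adj v u ∧ N.lev u + 1 = N.lev v := by
  obtain ⟨w, hw, hd⟩ := N.exists_adj_dist_succ h
  exact ⟨w, hw, by simpa [lev, SimpleGraph.dist_comm] using hd⟩

lemma lev_lt_card (v : V) : N.lev v < Fintype.card V := by
  obtain ⟨p, hp, hl⟩ := N.connected.exists_path_of_dist N.root v
  rw [lev, ← hl]
  exact hp.length_lt

/-- The identifiers of the neighbours on the previous level. -/
def upperIdents (v : V) : Set ℕ :=
  {i | ∃ u, N.graph.Adj v u ∧ N.lev u + 1 = N.lev v ∧ N.ident u = i}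

open Classical in
/-- The parent of a vertex in the search tree: the neighbour of least identifier on the previous
level. The leader is its own parent. -/
noncomputable def par (v : V) : V :=
  if h : ∃ u, N.graph.Adj v u ∧ N.lev u + 1 = N.lev v ∧ N.ident u = sInf (N.upperIdents v)
  then h.choose else v

lemma par_spec {v : V} (hv : v ≠ N.root) :
    N.graph.Adj v (N.par v) ∧ N.lev (N.par v) + 1 = N.lev v ∧
      N.ident (N.par v) = sInf (N.upperIdents v) := by
  have h : ∃ u, N.graph.Adj v u ∧ N.lev u + 1 = N.lev v ∧
      N.ident u = sInf (N.upperIdents v) := by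
    obtain ⟨u, hu⟩ := N.exists_upper hv
    exact Nat.sInf_mem (s := N.upperIdents v) ⟨_, u, hu.1, hu.2, rfl⟩
  rw [par, dif_pos h]
  exact h.choose_spec

lemma par_root : N.par N.root = N.root := by
  rw [par, dif_neg]
  rintro ⟨u, -, h, -⟩
  simp at h

/-- The endpoint of an edge that determines its value: the deeper one, or on equal levels the one
of larger identifier. -/
def Owns (u w : V) : Prop :=
  N.lev w < N.lev u ∨ N.lev w = N.lev u ∧ N.ident w < N.ident u

lemma Owns.asymm {N : Network V} {u w : V} (h : N.Owns u w) : ¬ N.Owns w u := by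
  unfold Owns at *; omega

lemma owns_or_owns {u w : V} (h : N.graph.Adj u w) : N.Owns u w ∨ N.Owns w u := by
  have : N.ident u ≠ N.ident w := fun e => h.ne (N.ident_injective e)
  unfold Owns; omega

lemma not_owns_iff {u w : V} (h : N.graph.Adj u w) : ¬ N.Owns u w ↔ N.Owns w u :=
  ⟨fun h' => (N.owns_or_owns h).resolve_left h', fun h' => h'.asymm⟩

lemma owns_par {v : V} (hv : v ≠ N.root) : N.Owns v (N.par v) := by
  have := (N.par_spec hv).2.1
  left; omega

/-- The edge from `u` to `w` is owned by `u` and does not lie in the search tree. -/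
def Free (u w : V) : Prop := N.graph.Adj u w ∧ N.Owns u w ∧ w ≠ N.par u

/-! ### The random circulation -/

section Flow

variable (x : V → V → Bool)

open Classical in
/-- The value of the edge from a vertex to its parent, for the given values of the free edges;
the first argument bounds the depth of the recursion. -/
noncomputable def upAux : ℕ → V → Bool
  | 0, _ => 0
  | m + 1, u => ∑ w ∈ (N.graph.neighborFinset u).erase (N.par u),
      if N.Owns u w then x u w else if u = N.par w then upAux m w else x w u

/-- The value of the edge from a vertex to its parent. -/
noncomputable def up (u : V) : Bool := N.upAux x (Fintype.card V - N.lev u) u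

open Classical in
/-- The circulation determined by the values of the free edges. -/
noncomputable def flow (u w : V) : Bool :=
  if N.Owns u w then (if w = N.par u then N.up x u else x u w)
  else (if u = N.par w then N.up x w else x w u)

lemma flow_symm {u w : V} (h : N.graph.Adj u w) : N.flow x u w = N.flow x w u := by
  unfold flow
  rcases N.owns_or_owns h with h | h
  · rw [if_pos h, if_neg h.asymm]
  · rw [if_pos h, if_neg h.asymm]

/-- The depth bound never runs out: a tree child lies one level deeper, and levels stay below the
number of vertices. Thus the recursion is conservation at `u`, solved for the parent edge. -/
lemma up_eq (u : V) :
    N.up x u = ∑ w ∈ (N.graph.neighborFinset u).erase (N.par u), N.flow x u w := by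
  have hu := N.lev_lt_card u
  obtain ⟨m, hm⟩ : ∃ m, Fintype.card V - N.lev u = m + 1 := ⟨Fintype.card V - N.lev u - 1, by omega⟩
  rw [up, hm, upAux]
  refine Finset.sum_congr rfl fun w hw => ?_
  rw [Finset.mem_erase, SimpleGraph.mem_neighborFinset] at hw
  unfold flow
  rw [if_neg hw.1]
  split_ifs with h1 h2
  · rfl
  · have hr : w ≠ N.root := by
      rintro rfl
      rw [par_root] at h2
      exact hw.2.ne h2
    have h3 := (N.par_spec hr).2.1
    rw [← h2] at h3
    rw [up, show Fintype.card V - N.lev w = m by omega]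
  · rfl

lemma flow_par {v : V} (hv : v ≠ N.root) : N.flow x v (N.par v) = N.up x v := by
  rw [flow, if_pos (N.owns_par hv), if_pos rfl]

lemma flow_free {u w : V} (h : N.Free u w) : N.flow x u w = x u w := by
  rw [flow, if_pos h.2.1, if_neg h.2.2]

lemma _root_.Bool.add_self' (a : Bool) : a + a = 0 := by cases a <;> rfl

lemma sum_flow_eq_zero {v : V} (hv : v ≠ N.root) :
    ∑ w ∈ N.graph.neighborFinset v, N.flow x v w = 0 := by
  have hp : N.par v ∈ N.graph.neighborFinset v := by
    rw [SimpleGraph.mem_neighborFinset]; exact (N.par_spec hv).1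
  rw [← Finset.add_sum_erase _ _ hp, ← up_eq, flow_par _ _ hv, Bool.add_self']

/-- The flow, extended by zero to pairs of vertices that are not adjacent. -/
noncomputable def flow₀ (u w : V) : Bool := if N.graph.Adj u w then N.flow x u w else 0

lemma flow₀_symm (u w : V) : N.flow₀ x u w = N.flow₀ x w u := by
  unfold flow₀
  by_cases h : N.graph.Adj u w
  · rw [if_pos h, if_pos h.symm, N.flow_symm x h]
  · rw [if_neg h, if_neg fun h' => h h'.symm]

lemma sum_flow₀ (v : V) (s : Finset V) (hs : s ⊆ N.graph.neighborFinset v) :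
    ∑ w ∈ s, N.flow x v w = ∑ w ∈ s, N.flow₀ x v w := by
  refine Finset.sum_congr rfl fun w hw => ?_
  have := hs hw
  rw [SimpleGraph.mem_neighborFinset] at this
  rw [flow₀, if_pos this]

lemma sum_flow₀_eq_zero {v : V} (hv : v ≠ N.root) : ∑ w, N.flow₀ x v w = 0 := by
  rw [← N.sum_flow_eq_zero x hv, N.sum_flow₀ x v _ subset_rfl]
  refine (Finset.sum_subset (Finset.subset_univ _) fun w _ hw => ?_).symm
  rw [SimpleGraph.mem_neighborFinset] at hw
  rw [flow₀, if_neg hw]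

lemma _root_.Bool.sum_sum_symm {α : Type*} [Fintype α] [DecidableEq α] (s : Finset α)
    (f : α → α → Bool) (hf : ∀ a b, f a b = f b a) (h0 : ∀ a, f a a = 0) :
    ∑ a ∈ s, ∑ b ∈ s, f a b = 0 := by
  rw [← Finset.sum_product']
  refine Finset.sum_involution (fun p _ => (p.2, p.1)) ?_ ?_ ?_ ?_
  · rintro ⟨a, b⟩ _
    simp only
    rw [hf b a, Bool.add_self']
  · rintro ⟨a, b⟩ _ h e
    simp only [Prod.mk.injEq] at e
    rw [e.1] at h
    exact h (h0 _)
  · rintro ⟨a, b⟩ h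
    simp only [Finset.mem_product] at h ⊢
    exact h.symm
  · rintro ⟨a, b⟩ _
    rfl

/-- The flow across a cut vanishes. -/
lemma sum_cut_eq_zero (s : Finset V) : ∑ u ∈ s, ∑ w ∈ sᶜ, N.flow₀ x u w = 0 := by
  -- Summing conservation over `s` counts inner edges twice, so they cancel and the cut remains.
  -- Conservation is imposed only off the leader; if `s` contains it, the complement has the same
  -- cut.
  have key : ∀ s : Finset V, N.root ∉ s → ∑ u ∈ s, ∑ w ∈ sᶜ, N.flow₀ x u w = 0 := by
    intro s hs
    have h1 : ∑ u ∈ s, ∑ w, N.flow₀ x u w = 0 :=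
      Finset.sum_eq_zero fun u hu => N.sum_flow₀_eq_zero x fun e => hs (e ▸ hu)
    have h2 := Bool.sum_sum_symm s (N.flow₀ x) (N.flow₀_symm x)
      (fun a => if_neg (N.graph.loopless.irrefl a))
    simp_rw [← Finset.sum_add_sum_compl s, Finset.sum_add_distrib] at h1
    rwa [h2, zero_add] at h1
  by_cases hs : N.root ∈ s
  · have := key sᶜ (by simpa using hs)
    rw [compl_compl] at this
    rw [Finset.sum_comm, ← this]
    exact Finset.sum_congr rfl fun u _ => Finset.sum_congr rfl fun w _ => N.flow₀_symm x _ _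
  · exact key s hs

end Flow

end Network

/-! ### Cut vertices and sums of the circulation at a vertex -/

namespace SimpleGraph

lemma Reachable.mem_of_closed {V : Type*} {G : SimpleGraph V} {s : Set V}
    (hs : ∀ u w, G.Adj u w → u ∈ s → w ∈ s) {a b : V} (h : G.Reachable a b) (ha : a ∈ s) :
    b ∈ s := by
  obtain ⟨p⟩ := h
  induction p with
  | nil => exact ha
  | cons h' _ ih => exact ih (hs _ _ h' ha)

end SimpleGraph

namespace Network

variable {V : Type*} [Fintype V] [DecidableEq V] (N : Network V)

/-- At a cut vertex some proper nonempty set of incident edges has flow zero. -/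
lemma exists_sum_flow_eq_zero {v : V} (hv : IsCutVertex N.graph v) :
    ∃ Y ⊆ N.graph.neighborFinset v, Y.Nonempty ∧ Y ≠ N.graph.neighborFinset v ∧
      ∀ x, ∑ w ∈ Y, N.flow x v w = 0 := by
  classical
  obtain ⟨a, b, hab⟩ : ∃ a b, ¬ (N.graph.induce {v}ᶜ).Reachable a b := by
    simpa [IsCutVertex, SimpleGraph.Preconnected] using hv
  -- The component of `a` after deleting `v`. Every edge leaving it ends at `v`, so the edges from
  -- `v` into it form a full cut.
  let s : Finset V := Finset.univ.filter fun u =>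
    ∃ h : u ∈ ({v}ᶜ : Set V), (N.graph.induce {v}ᶜ).Reachable a ⟨u, h⟩
  have hs : ∀ u, u ∈ s ↔ ∃ h : u ∈ ({v}ᶜ : Set V), (N.graph.induce {v}ᶜ).Reachable a ⟨u, h⟩ :=
    fun u => by simp [s]
  have hvs : v ∉ s := fun h => ((hs v).1 h).1 rfl
  have has : a.1 ∈ s := (hs _).2 ⟨a.2, SimpleGraph.Reachable.refl _⟩
  have hbs : b.1 ∉ s := fun h => hab ((hs _).1 h).2
  have hclosed : ∀ u w, N.graph.Adj u w → u ∈ s → w ≠ v → w ∈ s := by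
    intro u w huw hu hw
    obtain ⟨h, hr⟩ := (hs u).1 hu
    have : (N.graph.induce {v}ᶜ).Adj ⟨u, h⟩ ⟨w, hw⟩ := huw
    exact (hs w).2 ⟨hw, hr.trans this.reachable⟩
  refine ⟨N.graph.neighborFinset v ∩ s, Finset.inter_subset_left, ?_, ?_, fun x => ?_⟩
  · by_contra hne
    rw [Finset.not_nonempty_iff_eq_empty] at hne
    refine hvs (SimpleGraph.Reachable.mem_of_closed (s := ↑s) ?_ (N.connected a.1 v) has)
    intro u w huw hu
    refine hclosed u w huw hu ?_
    rintro rfl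
    have : u ∈ N.graph.neighborFinset w ∩ s := by
      rw [Finset.mem_inter, SimpleGraph.mem_neighborFinset]; exact ⟨huw.symm, hu⟩
    rw [hne] at this
    exact absurd this (Finset.notMem_empty u)
  · intro he
    have : v ∈ {u | u ∉ s ∧ u ≠ v} := by
      refine SimpleGraph.Reachable.mem_of_closed ?_ (N.connected b.1 v) ⟨hbs, b.2⟩
      rintro u w huw ⟨hu, huv⟩
      have hwv : w ≠ v := by
        rintro rfl
        have : u ∈ N.graph.neighborFinset w := by
          rw [SimpleGraph.mem_neighborFinset]; exact huw.symm
        rw [← he] at this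
        exact hu (Finset.mem_inter.1 this).2
      exact ⟨fun hw => hu (hclosed w u huw.symm hw huv), hwv⟩
    exact this.2 rfl
  · rw [N.sum_flow₀ x v _ Finset.inter_subset_left, ← N.sum_cut_eq_zero x s]
    have h1 : ∀ u ∈ s, ∑ w ∈ sᶜ, N.flow₀ x u w = N.flow₀ x u v := by
      intro u hu
      refine Finset.sum_eq_single_of_mem v (by simpa using hvs) fun w hw hwv => ?_
      rw [flow₀, if_neg]
      exact fun h => (Finset.mem_compl.1 hw) (hclosed u w h hu hwv)
    rw [Finset.sum_congr rfl h1, Finset.inter_comm]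
    refine (Finset.sum_subset Finset.inter_subset_left fun u hu hu' => ?_).trans
      (Finset.sum_congr rfl fun u _ => N.flow₀_symm x _ _)
    rw [flow₀, if_neg]
    intro h
    exact hu' (Finset.mem_inter.2 ⟨hu, by rwa [SimpleGraph.mem_neighborFinset]⟩)

open Classical in
/-- Indicator of a proposition in the field with two elements. -/
noncomputable def bit (p : Prop) : Bool := if p then 1 else 0

/-- Each edge has exactly one owner, so a sum over ordered pairs turns into one over owned pairs
with symmetrised weight. -/
lemma sum_owns (f a : V → V → Bool) (hf : ∀ u w, f u w = f w u)
    (h0 : ∀ u w, ¬ N.graph.Adj u w → f u w = 0) :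
    ∑ u, ∑ w, bit (N.Owns u w) * f u w * (a u w + a w u) = ∑ u, ∑ w, f u w * a u w := by
  have h1 : ∑ u, ∑ w, bit (N.Owns u w) * f u w * a w u
      = ∑ u, ∑ w, bit (N.Owns w u) * f u w * a u w := by
    rw [Finset.sum_comm]
    exact Finset.sum_congr rfl fun u _ => Finset.sum_congr rfl fun w _ => by rw [hf]
  simp_rw [mul_add, Finset.sum_add_distrib]
  rw [h1, ← Finset.sum_add_distrib]
  refine Finset.sum_congr rfl fun u _ => ?_
  rw [← Finset.sum_add_distrib]
  refine Finset.sum_congr rfl fun w _ => ?_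
  by_cases h : N.graph.Adj u w
  · rcases N.owns_or_owns h with h | h <;> simp [bit, h, h.asymm]
  · simp [h0 u w h]

/-- Sum of `m` along the tree path from a vertex to the leader. -/
noncomputable def pathSum (m : V → V → Bool) (u : V) : Bool :=
  ∑ k ∈ Finset.range (N.lev u), m (N.par^[k] u) (N.par^[k + 1] u)

lemma pathSum_par (m : V → V → Bool) {u : V} (hu : u ≠ N.root) :
    N.pathSum m u = N.pathSum m (N.par u) + m u (N.par u) := by
  rw [pathSum, ← (N.par_spec hu).2.1, Finset.sum_range_succ']
  rfl

/-- At a vertex that is not a cut vertex, the sum of the flow over a proper nonempty set of incident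
edges depends on some free edge. -/
lemma exists_sum_flow_eq_sum_free {v : V} (hv : ¬ IsCutVertex N.graph v) {Y : Finset V}
    (hY : Y ⊆ N.graph.neighborFinset v) (hne : Y.Nonempty) (hpr : Y ≠ N.graph.neighborFinset v) :
    ∃ c : V → V → Bool,
      (∀ x, ∑ w ∈ Y, N.flow x v w = ∑ u, ∑ w, bit (N.Free u w) * c u w * x u w) ∧
      ∃ u w, N.Free u w ∧ c u w = 1 := by
  classical
  let a : V → V → Bool := fun u w => bit (u = v ∧ w ∈ Y)
  let m : V → V → Bool := fun u w => a u w + a w u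
  -- A potential whose cut agrees with `m` on tree edges. Adding that cut to `m` gives `c`, which
  -- vanishes on the tree and pairs with every circulation as `m` does.
  let χ : V → Bool := N.pathSum m
  let c : V → V → Bool := fun u w => m u w + (χ u + χ w)
  have hms : ∀ u w, m u w = m w u := fun u w => add_comm _ _
  have hcs : ∀ u w, c u w = c w u := fun u w => by
    simp only [c]; rw [hms u w, add_comm (χ u)]
  have hpar : ∀ u, u ≠ N.root → c u (N.par u) = 0 := by
    intro u hu
    have := N.pathSum_par m hu
    change χ u = χ (N.par u) + m u (N.par u) at this
    simp only [c]
    rw [this]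
    generalize m u (N.par u) = p
    generalize χ (N.par u) = q
    cases p <;> cases q <;> rfl
  refine ⟨c, fun x => ?_, ?_⟩
  -- An unsymmetric half of `c`. The term `χ u * (1 + χ w)` selects the pairs leaving `{χ = 1}`, so
  -- it contributes the flow across a cut, which is zero.
  · let b : V → V → Bool := fun u w => a u w + χ u * (1 + χ w)
    have hb : ∀ u w, c u w = b u w + b w u := by
      intro u w
      simp only [c, b, m]
      generalize a u w = p
      generalize a w u = q
      generalize χ u = r
      generalize χ w = t
      cases p <;> cases q <;> cases r <;> cases t <;> rfl
    have h1 := N.sum_owns (N.flow₀ x) b (N.flow₀_symm x) (fun u w h => if_neg h)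
    have h2 : ∑ u, ∑ w, N.flow₀ x u w * b u w = ∑ w ∈ Y, N.flow x v w := by
      simp only [b, mul_add, Finset.sum_add_distrib]
      have h3 : ∑ u, ∑ w, N.flow₀ x u w * a u w = ∑ w ∈ Y, N.flow x v w := by
        rw [Finset.sum_eq_single_of_mem v (Finset.mem_univ _), N.sum_flow₀ x v Y hY]
        · rw [← Finset.sum_subset (Finset.subset_univ Y)]
          · exact Finset.sum_congr rfl fun w hw => by simp [a, bit, hw]
          · intro w _ hw
            simp [a, bit, hw]
        · intro u _ hu
          exact Finset.sum_eq_zero fun w _ => by simp [a, bit, hu]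
      have h4 := N.sum_cut_eq_zero x (Finset.univ.filter fun u => χ u = 1)
      have h5 : ∑ u, ∑ w, N.flow₀ x u w * (χ u * (1 + χ w)) = 0 := by
        rw [← h4, Finset.sum_filter]
        refine Finset.sum_congr rfl fun u _ => ?_
        have : (Finset.univ.filter fun u => χ u = 1)ᶜ = Finset.univ.filter fun u => ¬ χ u = 1 := by
          ext; simp
        rw [this, Finset.sum_filter]
        cases hu : χ u
        · simp [show (false : Bool) = 0 from rfl]
        · rw [if_pos (show true = 1 from rfl)]
          refine Finset.sum_congr rfl fun w _ => ?_
          generalize N.flow₀ x u w = p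
          cases hw : χ w <;> cases p <;> rfl
      have h6 : ∀ u w, N.flow₀ x u w * (χ u * (1 + χ w))
          = N.flow₀ x u w * (χ u * 1) + N.flow₀ x u w * (χ u * χ w) := by
        intros; ring
      simp_rw [h6, Finset.sum_add_distrib] at h5
      rw [h3, h5, add_zero]
    rw [← h2, ← h1]
    refine Finset.sum_congr rfl fun u _ => Finset.sum_congr rfl fun w _ => ?_
    rw [← hb]
    by_cases hf : N.Free u w
    · rw [flow₀, if_pos hf.1, N.flow_free x hf]
      simp only [bit, hf, hf.2.1, if_true]
      ring
    · rw [show bit (N.Free u w) = 0 from if_neg hf]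
      rw [zero_mul, zero_mul]
      by_cases ho : N.Owns u w
      · by_cases hA : N.graph.Adj u w
        · have hw : w = N.par u := by
            by_contra hw
            exact hf ⟨hA, ho, hw⟩
          have hu : u ≠ N.root := by
            rintro rfl
            rw [par_root] at hw
            exact hA.ne hw.symm
          rw [hw, hpar u hu, mul_zero]
        · rw [flow₀, if_neg hA, mul_zero, zero_mul]
      · rw [bit, if_neg ho, zero_mul, zero_mul]
  -- If `c` vanished on free edges too, `m` would be the cut of `χ`. Away from `v` the graph is
  -- connected and `m` is zero, so `χ` is constant there and `m` takes a single value on the edges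
  -- at `v`; but it is 1 on `Y` and 0 off `Y`.
  · by_contra hcon
    push Not at hcon
    have hc0 : ∀ u w, N.graph.Adj u w → N.Owns u w → c u w = 0 := by
      intro u w hA ho
      by_cases hw : w = N.par u
      · rw [hw]
        refine hpar u ?_
        rintro rfl
        rw [par_root] at hw
        exact hA.ne hw.symm
      · have := hcon u w ⟨hA, ho, hw⟩
        revert this
        generalize c u w = p
        cases p <;> simp [show (false : Bool) = 0 from rfl, show (true : Bool) = 1 from rfl]
    have hc : ∀ u w, N.graph.Adj u w → m u w = χ u + χ w := by
      intro u w hA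
      have : c u w = 0 := by
        rcases N.owns_or_owns hA with h | h
        · exact hc0 u w hA h
        · rw [hcs]; exact hc0 w u hA.symm h
      simp only [c] at this
      revert this
      generalize m u w = p
      generalize χ u + χ w = q
      cases p <;> cases q <;> decide
    obtain ⟨y, hy⟩ := hne
    obtain ⟨z, hz, hzY⟩ : ∃ z ∈ N.graph.neighborFinset v, z ∉ Y := by
      by_contra h
      push Not at h
      exact hpr (Finset.Subset.antisymm hY h)
    have hyv := hY hy
    rw [SimpleGraph.mem_neighborFinset] at hyv hz
    have hvY : v ∉ Y := fun h => by
      have := hY h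
      rw [SimpleGraph.mem_neighborFinset] at this
      exact this.ne rfl
    have e1 := hc v y hyv
    have e2 := hc v z hz
    have e3 : m v y = 1 := by simp [m, a, bit, hy, hvY]
    have e4 : m v z = 0 := by simp [m, a, bit, hzY, hvY]
    have hpre : (N.graph.induce {v}ᶜ).Preconnected := by
      by_contra h; exact hv h
    have hr := hpre ⟨y, hyv.ne'⟩ ⟨z, hz.ne'⟩
    have : χ z = χ y := by
      refine SimpleGraph.Reachable.mem_of_closed (s := {u : ({v}ᶜ : Set V) | χ u.1 = χ y}) ?_ hr rfl
      intro u w huw hu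
      have e5 := hc u.1 w.1 huw
      have e6 : m u.1 w.1 = 0 := by
        have h1 : u.1 ≠ v := u.2
        have h2 : w.1 ≠ v := w.2
        simp [m, a, bit, h1, h2]
      rw [e6] at e5
      change χ w.1 = χ y
      rw [← (show χ u.1 = χ y from hu)]
      revert e5
      generalize χ u.1 = p
      generalize χ w.1 = q
      cases p <;> cases q <;> decide
    rw [e3, ← this] at e1
    rw [e4] at e2
    exact absurd (e1.trans e2.symm) (by decide)

end Network

/-! ### Error probability of the test -/

open MeasureTheory

section Coins

variable {ι : Type*}

/-- The product of uniform measures on coin flips. -/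
noncomputable abbrev fairCoins (ι : Type*) : Measure (ι → Bool) :=
  Measure.infinitePi fun _ => (PMF.uniformOfFintype Bool).toMeasure

lemma map_add_uniformOfFintype_bool (a : Bool) :
    Measure.map (fun x => x + a) (PMF.uniformOfFintype Bool).toMeasure
      = (PMF.uniformOfFintype Bool).toMeasure := by
  cases a
  · have : (fun x : Bool => x + false) = id := by funext x; cases x <;> rfl
    rw [this, Measure.map_id]
  · refine Measure.ext_of_singleton fun b => ?_
    rw [Measure.map_apply Measurable.of_discrete (measurableSet_singleton b)]
    have : (fun x : Bool => x + true) ⁻¹' {b} = {!b} := by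
      ext x; cases x <;> cases b <;> simp [Bool.add_eq_xor]
    rw [this, PMF.toMeasure_apply_singleton _ _ (measurableSet_singleton _),
      PMF.toMeasure_apply_singleton _ _ (measurableSet_singleton _)]
    simp

/-- Flipping a fixed set of coins preserves the measure. -/
lemma measurePreserving_flip (g : ι → Bool) :
    MeasurePreserving (fun ω : ι → Bool => fun i => ω i + g i) (fairCoins ι) (fairCoins ι) := by
  refine ⟨measurable_pi_lambda _ fun i =>
    (Measurable.of_discrete (f := fun x : Bool => x + g i)).comp (measurable_pi_apply i), ?_⟩
  rw [Measure.infinitePi_map_pi (f := fun i x => x + g i) _ fun i => Measurable.of_discrete]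
  simp_rw [map_add_uniformOfFintype_bool]

/-- If each of `b` random bits can be flipped by means of a coin that does not affect the others,
then all of them vanish with probability at most `2⁻ᵇ`. -/
lemma fairCoins_forall_eq_zero_le (b : ℕ) (f : ℕ → (ι → Bool) → Bool)
    (hf : ∀ j, Measurable (f j)) (g : Finset ℕ → ι → Bool)
    (hfg : ∀ s ω, ∀ j < b, f j (fun i => ω i + g s i) = f j ω + Network.bit (j ∈ s)) :
    (fairCoins ι).real {ω | ∀ j < b, f j ω = 0} ≤ (1 / 2) ^ b := by
  classical
  -- The events for the `2 ^ b` patterns are disjoint, and measure-preserving flips carry them to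
  -- one another, so they share a total of at most 1 equally. Independence of the bits need not be
  -- formulated.
  let E : Finset ℕ → Set (ι → Bool) := fun s => {ω | ∀ j < b, f j ω = Network.bit (j ∈ s)}
  have hE : ∀ s, MeasurableSet (E s) := by
    intro s
    have : E s = ⋂ j, ⋂ _ : j < b, f j ⁻¹' {Network.bit (j ∈ s)} := by
      ext ω; simp [E]
    rw [this]
    exact MeasurableSet.iInter fun j => MeasurableSet.iInter fun _ =>
      hf j (measurableSet_singleton _)
  have h0 : {ω | ∀ j < b, f j ω = 0} = E ∅ := by
    ext ω; simp [E, Network.bit]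
  have hEs : ∀ s, (fairCoins ι).real (E s) = (fairCoins ι).real (E ∅) := by
    intro s
    rw [← (measurePreserving_flip (g s)).measureReal_preimage (hE s).nullMeasurableSet]
    congr 1
    ext ω
    simp only [E, Set.mem_preimage, Set.mem_ofPred_eq]
    refine forall₂_congr fun j hj => ?_
    rw [hfg s ω j hj]
    generalize f j ω = p
    by_cases h : j ∈ s <;> cases p <;>
      simp [Network.bit, h, Bool.add_eq_xor, Bool.zero_eq_false, Bool.one_eq_true]
  have hdisj : ∀ s ∈ (Finset.range b).powerset, ∀ t ∈ (Finset.range b).powerset, s ≠ t →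
      Disjoint (E s) (E t) := by
    intro s hs t ht hst
    rw [Set.disjoint_left]
    intro ω h1 h2
    refine hst (Finset.ext fun j => ?_)
    rw [Finset.mem_powerset] at hs ht
    by_cases hj : j < b
    · have := (h1 j hj).symm.trans (h2 j hj)
      by_cases h3 : j ∈ s <;> by_cases h4 : j ∈ t <;> simp_all [Network.bit]
    · exact ⟨fun h => absurd (Finset.mem_range.1 (hs h)) hj,
        fun h => absurd (Finset.mem_range.1 (ht h)) hj⟩
  have hsum := measureReal_biUnion_finset (μ := fairCoins ι) (s := (Finset.range b).powerset)
    (f := E) (fun s hs t ht hst => hdisj s hs t ht hst) (fun s _ => hE s)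
  have hle : (fairCoins ι).real (⋃ s ∈ (Finset.range b).powerset, E s) ≤ 1 := measureReal_le_one
  rw [hsum, Finset.sum_congr rfl fun s _ => hEs s, Finset.sum_const, Finset.card_powerset,
    Finset.card_range, nsmul_eq_mul] at hle
  rw [h0, one_div, inv_pow, ← one_div, le_div_iff₀ (by positivity), mul_comm]
  exact_mod_cast hle

end Coins

namespace Network

variable {V : Type*} [Fintype V] [DecidableEq V] (N : Network V)

/-- Bit `j` of the value of a free edge, when the coins of round `S` are used. -/
def coinValue (S : ℕ) (ω : DistributedAlgorithm.Coins V) (j : ℕ) (u w : V) : Bool :=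
  ω (u, S, Nat.pair (N.ident w) j)

/-- Some free edge enters the sum with coefficient 1. Its coins for different `j` are distinct, and
flipping the `j`-th one changes the sum for bit `j` only. -/
lemma measureReal_sum_flow_le {v : V} (hv : ¬ IsCutVertex N.graph v) {Y : Finset V}
    (hY : Y ⊆ N.graph.neighborFinset v) (hne : Y.Nonempty) (hpr : Y ≠ N.graph.neighborFinset v)
    (S b : ℕ) :
    (DistributedAlgorithm.coinMeasure V).real
      {ω | ∀ j < b, ∑ w ∈ Y, N.flow (N.coinValue S ω j) v w = 0} ≤ (1 / 2) ^ b := by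
  classical
  obtain ⟨c, hc, u₀, w₀, hfree, hc0⟩ := N.exists_sum_flow_eq_sum_free hv hY hne hpr
  simp_rw [hc]
  refine fairCoins_forall_eq_zero_le b
    (fun j ω => ∑ u, ∑ w, bit (N.Free u w) * c u w * N.coinValue S ω j u w) (fun j => ?_)
    (fun s i => bit (∃ k ∈ s, i = (u₀, S, Nat.pair (N.ident w₀) k))) fun s ω j _ => ?_
  · refine Finset.measurable_fun_sum _ fun u _ => Finset.measurable_fun_sum _ fun w _ => ?_
    exact (Measurable.of_discrete (f := fun y : Bool => bit (N.Free u w) * c u w * y)).comp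
      (measurable_pi_apply _)
  · have h1 : ∀ u w, N.coinValue S
        (fun i => ω i + bit (∃ k ∈ s, i = (u₀, S, Nat.pair (N.ident w₀) k))) j u w
        = N.coinValue S ω j u w + (if u = u₀ then if w = w₀ then bit (j ∈ s) else 0 else 0) := by
      intro u w
      simp only [coinValue]
      congr 1
      simp only [Prod.mk.injEq, true_and, Nat.pair_eq_pair, N.ident_injective.eq_iff]
      by_cases hu : u = u₀ <;> by_cases hw : w = w₀ <;> simp [bit, hu, hw]
    simp_rw [h1, mul_add, Finset.sum_add_distrib]
    congr 1
    rw [Finset.sum_eq_single_of_mem u₀ (Finset.mem_univ _),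
      Finset.sum_eq_single_of_mem w₀ (Finset.mem_univ _)]
    · rw [if_pos rfl, if_pos rfl, hc0, show bit (N.Free u₀ w₀) = 1 from if_pos hfree, one_mul,
        one_mul]
    · intro w _ hw
      rw [if_pos rfl, if_neg hw, mul_zero]
    · intro u _ hu
      exact Finset.sum_eq_zero fun w _ => by rw [if_neg hu, mul_zero]

/-- With high probability the flow detects exactly the cut vertices. -/
lemma measureReal_flow_detects (S b L : ℕ) (hL : Fintype.card V ≤ 2 ^ L)
    (hb : N.graph.maxDegree + 2 * L ≤ b) :
    1 - 1 / (Fintype.card V : ℝ) ≤ (DistributedAlgorithm.coinMeasure V).real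
      {ω | ∀ v, (∃ Y ⊆ N.graph.neighborFinset v, Y.Nonempty ∧ Y ≠ N.graph.neighborFinset v ∧
        ∀ j < b, ∑ w ∈ Y, N.flow (N.coinValue S ω j) v w = 0) ↔ IsCutVertex N.graph v} := by
  classical
  have : IsProbabilityMeasure (DistributedAlgorithm.coinMeasure V) := by
    unfold DistributedAlgorithm.coinMeasure; infer_instance
  set good := {ω | ∀ v, (∃ Y ⊆ N.graph.neighborFinset v, Y.Nonempty ∧
    Y ≠ N.graph.neighborFinset v ∧
    ∀ j < b, ∑ w ∈ Y, N.flow (N.coinValue S ω j) v w = 0) ↔ IsCutVertex N.graph v} with hgood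
  let P : V → Finset (Finset V) := fun v => (N.graph.neighborFinset v).powerset.filter fun Y =>
    Y.Nonempty ∧ Y ≠ N.graph.neighborFinset v ∧ ¬ IsCutVertex N.graph v
  let bad : V → Finset V → Set (DistributedAlgorithm.Coins V) := fun v Y =>
    {ω | ∀ j < b, ∑ w ∈ Y, N.flow (N.coinValue S ω j) v w = 0}
  -- Errors are one-sided: at a cut vertex the separating set passes for every outcome of the coins,
  -- so only false positives remain.
  have hsub : goodᶜ ⊆ ⋃ v ∈ Finset.univ, ⋃ Y ∈ P v, bad v Y := by
    intro ω hω
    rw [Set.mem_compl_iff, hgood, Set.mem_ofPred_eq] at hω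
    push Not at hω
    obtain ⟨v, ⟨⟨Y, h1, h2, h3, h4⟩, h5⟩ | ⟨h1, h2⟩⟩ := hω
    · simp only [Set.mem_iUnion]
      exact ⟨v, Finset.mem_univ _, Y,
        Finset.mem_filter.2 ⟨Finset.mem_powerset.2 h1, h2, h3, h5⟩, h4⟩
    · obtain ⟨Y, h3, h4, h5, h6⟩ := N.exists_sum_flow_eq_zero h2
      obtain ⟨j, hj, hne⟩ := h1 Y h3 h4 h5
      exact absurd (h6 _) hne
  have hbad : ∀ v, (DistributedAlgorithm.coinMeasure V).real (⋃ Y ∈ P v, bad v Y)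
      ≤ 2 ^ N.graph.maxDegree * (1 / 2) ^ b := by
    intro v
    refine (measureReal_biUnion_finset_le _ _).trans ?_
    refine (Finset.sum_le_card_nsmul _ _ ((1 / 2 : ℝ) ^ b) fun Y hY => ?_).trans ?_
    · obtain ⟨h1, h2, h3, h4⟩ := Finset.mem_filter.1 hY
      exact N.measureReal_sum_flow_le h4 (Finset.mem_powerset.1 h1) h2 h3 S b
    · rw [nsmul_eq_mul]
      gcongr
      have h1 : (P v).card ≤ 2 ^ N.graph.maxDegree := by
        refine (Finset.card_filter_le _ _).trans ?_
        rw [Finset.card_powerset, SimpleGraph.card_neighborFinset_eq_degree]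
        exact Nat.pow_le_pow_right (by norm_num) (N.graph.degree_le_maxDegree v)
      exact_mod_cast h1
  have hcard : (0 : ℝ) < Fintype.card V := by
    have := N.two_le_card
    exact_mod_cast (by omega : 0 < Fintype.card V)
  have htotal : (DistributedAlgorithm.coinMeasure V).real goodᶜ ≤ 1 / (Fintype.card V : ℝ) := by
    refine (measureReal_mono hsub (measure_ne_top _ _)).trans ((measureReal_biUnion_finset_le _ _).trans ?_)
    refine (Finset.sum_le_sum fun v _ => hbad v).trans ?_
    rw [Finset.sum_const, nsmul_eq_mul, Finset.card_univ, le_div_iff₀ hcard]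
    have hn : (Fintype.card V : ℝ) ≤ 2 ^ L := by exact_mod_cast hL
    calc (Fintype.card V : ℝ) * (2 ^ N.graph.maxDegree * (1 / 2) ^ b) * Fintype.card V
        ≤ 2 ^ L * (2 ^ N.graph.maxDegree * (1 / 2) ^ (N.graph.maxDegree + 2 * L)) * 2 ^ L := by
          have : ((1 : ℝ) / 2) ^ b ≤ (1 / 2) ^ (N.graph.maxDegree + 2 * L) :=
            pow_le_pow_of_le_one (by norm_num) (by norm_num) hb
          gcongr
      _ = 1 := by
          rw [one_div, inv_pow, pow_add, two_mul L, pow_add]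
          field_simp
  -- Subadditivity suffices here, so measurability of `good` is not needed.
  have h1 : (1 : ℝ) ≤ (DistributedAlgorithm.coinMeasure V).real good
      + (DistributedAlgorithm.coinMeasure V).real goodᶜ := by
    have := measureReal_union_le (μ := DistributedAlgorithm.coinMeasure V) good goodᶜ
    rwa [Set.union_compl_self, probReal_univ] at this
  linarith

end Network

/-! ### The protocol -/

/-- Encoding of a pair of numbers, the first one in unary and the second one in binary. -/
def encodePair (p : ℕ × ℕ) : Message := List.replicate p.1 true ++ false :: p.2.bits

lemma Nat.bits_injective : Function.Injective Nat.bits := by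
  intro a b h
  refine Nat.eq_of_testBit_eq fun i => ?_
  rw [Nat.testBit_eq_inth, Nat.testBit_eq_inth, h]

/-- The unary part is self-delimiting: it ends at the first `false`. It will carry the size of an
identifier, so unary costs no more than the identifier itself. -/
lemma encodePair_injective : Function.Injective encodePair := by
  rintro ⟨a, c⟩ ⟨b, d⟩ h
  simp only [encodePair] at h
  induction a generalizing b with
  | zero =>
    cases b with
    | zero => simpa [Nat.bits_injective.eq_iff] using h
    | succ b => simp [List.replicate_succ] at h
  | succ a ih =>
    cases b with
    | zero => simp [List.replicate_succ] at h
    | succ b =>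
      have := ih b (by simpa [List.replicate_succ] using h)
      simpa using this

lemma length_encodePair (p : ℕ × ℕ) : (encodePair p).length = p.1 + 1 + p.2.size := by
  simp [encodePair, Nat.size_eq_bits_len]
  omega

/-- Inverse of `encodePair`. -/
noncomputable def decodePair (m : Message) : ℕ × ℕ := Function.invFun encodePair m

@[simp] lemma decodePair_encodePair (p : ℕ × ℕ) : decodePair (encodePair p) = p :=
  Function.leftInverse_invFun encodePair_injective p

/-- The memory of a processor: everything it has been told, received and flipped so far. -/
structure View where
  /-- own identifier -/
  ident : ℕ
  /-- identifiers of the neighbours -/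
  nbrs : Finset ℕ
  /-- the leader flag -/
  leader : Bool
  /-- number of rounds carried out -/
  rounds : ℕ
  /-- `inb s i` is the message received from `i` at the start of round `s` -/
  inb : ℕ → Mailbox
  /-- `coin s i` is the `i`-th coin flipped in round `s` -/
  coin : ℕ → ℕ → Bool

namespace View

open Classical

noncomputable section

variable (v : View)

/-- A message from `i` was received at the start of round `s`. -/
def Heard (s i : ℕ) : Prop := (v.inb s i).isSome

/-- The vertex is reached by the search. -/
def Awake : Prop := v.leader = true ∨ ∃ s i, v.Heard s i

/-- Distance from the leader: the round of the first message. -/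
def level : ℕ := if v.leader then 0 else sInf {s | ∃ i, v.Heard s i}

/-- The round of the first message from `i`; this is the level of `i` plus one. -/
def first (i : ℕ) : ℕ := sInf {s | v.Heard s i}

/-- The round of the second message from `i`. -/
def second (i : ℕ) : ℕ := sInf {s | v.first i < s ∧ v.Heard s i}

/-- The neighbours on the next level. -/
def lower : Finset ℕ := v.nbrs.filter fun i => v.first i = v.level + 2

/-- All neighbours on the next level have reported. -/
def Ready : Prop :=
  v.Awake ∧ v.level + 2 < v.rounds ∧ ∀ i ∈ v.lower, ∃ s, v.first i < s ∧ v.Heard s i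

/-- The round in which the vertex becomes ready. -/
def echoTime : ℕ := max (v.level + 2) (v.lower.sup v.second)

/-- The pair of numbers in the second message from `i`. -/
def content (i : ℕ) : ℕ × ℕ := decodePair ((v.inb (v.second i) i).getD [])

/-- The maximum of the identifier sizes and degrees of the vertices below. -/
def report : ℕ × ℕ :=
  (max v.ident.size (v.lower.sup fun i => (v.content i).1),
    max v.nbrs.card (v.lower.sup fun i => (v.content i).2))

/-- The identifier of the parent in the search tree. -/
def parentId : ℕ := sInf {i | i ∈ v.nbrs ∧ v.first i = v.level}

/-- The vertex knows the global parameters. -/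
def Informed : Prop :=
  if v.leader then v.Ready
  else v.Awake ∧ v.level + 2 < v.rounds ∧ ∃ s, v.first v.parentId < s ∧ v.Heard s v.parentId

/-- The round in which the leader becomes ready. -/
def announceTime : ℕ := if v.leader then v.echoTime else v.second v.parentId - v.level

/-- The chunk width (the maximal size of an identifier) and the maximal degree. -/
def params : ℕ × ℕ := if v.leader then v.report else v.content v.parentId

/-- Number of chunks into which the value of an edge is divided. -/
def chunks : ℕ := v.params.2 / v.params.1 + 3

/-- Number of bits of the value of an edge. -/
def bits : ℕ := v.chunks * v.params.1

/-- The edge to `i` is owned by this vertex. -/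
def Owned (i : ℕ) : Prop := v.first i = v.level ∨ v.first i = v.level + 1 ∧ i < v.ident

/-- The round in which the transmission to `i` starts. -/
def sendStart (i : ℕ) : ℕ :=
  if v.first i = v.level + 1 then 2 * v.announceTime else 3 * v.announceTime + 1 - v.level

/-- The round in which the transmission from `i` starts to arrive. -/
def arrivalStart (i : ℕ) : ℕ :=
  if v.first i = v.level + 1 then 2 * v.announceTime + 1 else 3 * v.announceTime + 1 - v.level

/-- Bit `j` of the value of the edge to `i`, as received from `i`. -/
def received (i j : ℕ) : Bool :=
  ((v.inb (v.arrivalStart i + j / v.params.1) i).getD []).getD (j % v.params.1) false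

/-- Bit `j` of the value of the edge to `i`, if `i` is not the parent. -/
def offTree (i j : ℕ) : Bool :=
  if v.Owned i then v.coin (2 * v.announceTime) (Nat.pair i j) else v.received i j

/-- Bit `j` of the value of the edge to `i`. -/
def value (i j : ℕ) : Bool :=
  if v.Owned i ∧ i = v.parentId then ∑ k ∈ v.nbrs.erase v.parentId, v.offTree k j
  else v.offTree i j

/-- The messages sent after the given history. -/
def outbox (i : ℕ) : Option Message :=
  if ¬ v.Awake then none
  else if v.rounds = v.level + 1 then some []
  else if v.Ready ∧ v.first i = v.level ∧ v.rounds = v.echoTime + 1 then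
    some (encodePair v.report)
  else if v.Informed ∧ v.first i = v.level + 2 ∧ v.rounds = v.announceTime + v.level + 1 then
    some (encodePair v.params)
  else if v.Informed ∧ v.Owned i ∧ v.sendStart i < v.rounds ∧
      v.rounds ≤ v.sendStart i + v.chunks then
    some (List.ofFn fun j : Fin v.params.1 =>
      v.value i ((v.rounds - 1 - v.sendStart i) * v.params.1 + j))
  else none

/-- Number of coins to be flipped. -/
def coinCount : ℕ :=
  (v.nbrs ×ˢ Finset.range v.bits).sup (fun p => Nat.pair p.1 p.2) + 1

/-- The vertex has halted. -/
def Done : Prop := v.Informed ∧ 3 * v.announceTime + v.chunks + 1 ≤ v.rounds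

/-- The output: is there a proper nonempty set of incident edges of total value zero? -/
def output : Option Bool :=
  if v.Done then some (decide (∃ Y ⊆ v.nbrs, Y.Nonempty ∧ Y ≠ v.nbrs ∧
    ∀ j < v.bits, ∑ i ∈ Y, v.value i j = 0))
  else none

/-- Record the messages received in a new round. -/
def receive (m : Mailbox) : View :=
  { v with rounds := v.rounds + 1, inb := Function.update v.inb v.rounds m }

/-- Record the coins flipped in a round. -/
def record (s n : ℕ) (c : Fin n → Bool) : View :=
  { v with coin := Function.update v.coin s fun i => if h : i < n then c ⟨i, h⟩ else false }

end

end View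

/-- The algorithm of Pritchard and Thurimella for finding cut vertices. -/
noncomputable def cutVertexAlgorithm : DistributedAlgorithm where
  State := View
  start i s l :=
    { ident := i, nbrs := s, leader := l, rounds := 0, inb := fun _ _ => none
      coin := fun _ _ => false }
  coins v m := (v.receive m).coinCount
  step v m c :=
    (((v.receive m).record v.rounds _ c), ((v.receive m).record v.rounds _ c).outbox)
  output v := v.output

/-! ### Closed form of the execution -/

namespace Network

variable {V : Type*} [Fintype V] [DecidableEq V] (N : Network V)

/-- The vertices reached from the leader by a shortest path through `v`. -/
noncomputable def below (v : V) : Finset V :=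
  Finset.univ.filter fun u => N.lev u = N.lev v + N.graph.dist v u

/-- The neighbours on the next level. -/
noncomputable def lower (v : V) : Finset V :=
  (N.graph.neighborFinset v).filter fun u => N.lev u = N.lev v + 1

/-- The maximal level of a vertex below `v`. -/
noncomputable def height (v : V) : ℕ := (N.below v).sup N.lev

/-- The maximal size of an identifier below `v`. -/
noncomputable def widthBelow (v : V) : ℕ := (N.below v).sup fun u => (N.ident u).size

/-- The maximal degree below `v`. -/
noncomputable def degreeBelow (v : V) : ℕ := (N.below v).sup fun u => N.graph.degree u

/-- The round in which `v` has heard from everything below. -/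
noncomputable def echo (v : V) : ℕ := 2 * N.height v + 2 - N.lev v

/-- The round in which the leader has heard from everything. -/
noncomputable def announce : ℕ := 2 * N.height N.root + 2

/-- The width of a chunk. -/
noncomputable def width : ℕ := N.widthBelow N.root

/-- The number of chunks. -/
noncomputable def chunks : ℕ := N.degreeBelow N.root / N.width + 3

/-- The round in which the transmission from `u` to `w` starts. -/
noncomputable def sendStart (u w : V) : ℕ :=
  if N.lev w = N.lev u then 2 * N.announce else 3 * N.announce + 1 - N.lev u

variable (ω : DistributedAlgorithm.Coins V)

/-- The value of bit `j` of the edge from `u` to `w`. -/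
noncomputable def edgeBit (j : ℕ) (u w : V) : Bool :=
  N.flow (N.coinValue (2 * N.announce) ω j) u w

open Classical in
/-- Closed form of the messages that arrive in round `t`. -/
noncomputable def mail (t : ℕ) (u w : V) : Option Message :=
  if ¬ N.graph.Adj u w then none
  else if t = N.lev u + 1 then some []
  else if N.lev w + 1 = N.lev u ∧ t = N.echo u + 1 then
    some (encodePair (N.widthBelow u, N.degreeBelow u))
  else if N.lev w = N.lev u + 1 ∧ t = N.announce + N.lev u + 1 then
    some (encodePair (N.width, N.degreeBelow N.root))
  else if N.Owns u w ∧ N.sendStart u w < t ∧ t ≤ N.sendStart u w + N.chunks then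
    some (List.ofFn fun j : Fin N.width =>
      N.edgeBit ω ((t - 1 - N.sendStart u w) * N.width + j) u w)
  else none

/-- The view of `v` after `n` rounds, without the coins. -/
noncomputable def listen (v : V) (n : ℕ) : View where
  ident := N.ident v
  nbrs := (N.graph.neighborFinset v).image N.ident
  leader := decide (v = N.root)
  rounds := n
  inb s := if s < n then Function.extend N.ident (fun u => N.mail ω s u v) (fun _ => none)
    else fun _ => none
  coin _ _ := false

/-- The view of `v` after `n` rounds. -/
noncomputable def view (v : V) (n : ℕ) : View :=
  { N.listen ω v n with
    coin := fun s i => if s < n ∧ i < (N.listen ω v (s + 1)).coinCount then ω (v, s, i) else false }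

end Network

/-! ### Echo recursion and separation of the phases -/

namespace Network

variable {V : Type*} [Fintype V] [DecidableEq V] (N : Network V)

lemma self_mem_below (v : V) : v ∈ N.below v := by simp [below]

lemma mem_lower {u v : V} : u ∈ N.lower v ↔ N.graph.Adj v u ∧ N.lev u = N.lev v + 1 := by
  simp [lower]

lemma below_eq (v : V) : N.below v = insert v ((N.lower v).biUnion N.below) := by
  ext u
  simp only [below, Finset.mem_filter, Finset.mem_univ, true_and, Finset.mem_insert,
    Finset.mem_biUnion, mem_lower]
  constructor
  · intro h
    by_cases huv : v = u
    · exact Or.inl huv.symm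
    · obtain ⟨w, hw, hd⟩ := N.exists_adj_dist_succ huv
      have h1 := N.connected.dist_triangle (u := N.root) (v := w) (w := u)
      have h2 := N.lev_le_of_adj hw
      simp only [lev] at *
      exact Or.inr ⟨w, ⟨hw, by omega⟩, by omega⟩
  · rintro (rfl | ⟨w, ⟨hw, h1⟩, h2⟩)
    · simp
    · have h3 := N.connected.dist_triangle (u := N.root) (v := v) (w := u)
      have h4 := N.connected.dist_triangle (u := v) (v := w) (w := u)
      rw [SimpleGraph.dist_eq_one_iff_adj.2 hw] at h4
      simp only [lev] at *
      omega

lemma below_root : N.below N.root = Finset.univ := by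
  ext u; simp [below]; rfl

/-- The recursion computed by the echo. The sets below different neighbours may overlap, which is
harmless for a maximum; hence echoes may go to all upper neighbours, not only the parent. -/
lemma sup_below (f : V → ℕ) (v : V) :
    (N.below v).sup f = max (f v) ((N.lower v).sup fun u => (N.below u).sup f) := by
  conv_lhs => rw [below_eq]
  rw [Finset.sup_insert, Finset.sup_biUnion]

lemma lev_le_height (v : V) : N.lev v ≤ N.height v :=
  Finset.le_sup (f := N.lev) (N.self_mem_below v)

lemma sup_below_le (f : V → ℕ) (v : V) : (N.below v).sup f ≤ (N.below N.root).sup f :=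
  Finset.sup_mono (by rw [below_root]; exact Finset.subset_univ _)

lemma height_le (v : V) : N.height v ≤ N.height N.root := N.sup_below_le _ v

lemma lev_add_two_le_echo (v : V) : N.lev v + 2 ≤ N.echo v := by
  have := N.lev_le_height v
  unfold echo; omega

lemma echo_le_announce (v : V) : N.echo v ≤ N.announce := by
  have := N.height_le v
  unfold echo announce; omega

lemma echo_root : N.echo N.root = N.announce := by simp [echo, announce]

/-- Separates the phases: the announcement reaches level `ℓ` in round `announce + ℓ`, hence before
round `2 * announce`, whose coins define the circulation. -/
lemma two_mul_lev_le_announce (v : V) : 2 * N.lev v + 2 ≤ N.announce := by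
  have := N.height_le v
  have := N.lev_le_height v
  unfold announce; omega

lemma two_mul_announce_le_sendStart (u w : V) : 2 * N.announce ≤ N.sendStart u w := by
  have := N.two_mul_lev_le_announce u
  unfold sendStart; split_ifs <;> omega

/-- The closed form solves the waiting rule: `v` waits until round `lev v + 2`, when every neighbour
has been heard once, and for all echoes from the next level, each one round in transit. -/
lemma echo_eq (v : V) :
    N.echo v = max (N.lev v + 2) ((N.lower v).sup fun u => N.echo u + 1) := by
  have hh := N.sup_below N.lev v
  change N.height v = max _ ((N.lower v).sup N.height) at hh
  apply le_antisymm
  · rcases (N.lower v).eq_empty_or_nonempty with he | hne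
    · rw [he, Finset.sup_empty, Nat.bot_eq_zero, Nat.max_zero] at hh
      refine le_max_of_le_left ?_
      unfold echo; omega
    · obtain ⟨u, hu, hmax⟩ := Finset.exists_mem_eq_sup _ hne N.height
      have h1 := (N.mem_lower.1 hu).2
      have h2 := N.lev_le_height u
      have h3 := Finset.le_sup (f := fun u => N.echo u + 1) hu
      refine le_max_of_le_right (le_trans ?_ h3)
      rw [hmax, max_eq_right (by omega)] at hh
      unfold echo; omega
  · refine max_le (N.lev_add_two_le_echo v) (Finset.sup_le fun u hu => ?_)
    have h1 : N.height u ≤ N.height v := by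
      rw [hh]; exact le_max_of_le_right (Finset.le_sup (f := N.height) hu)
    have := (N.mem_lower.1 hu).2
    have := N.lev_le_height u
    unfold echo; omega

variable (ω : DistributedAlgorithm.Coins V)

lemma mail_isSome {t : ℕ} {u w : V} (h : (N.mail ω t u w).isSome) :
    N.graph.Adj u w ∧ (t = N.lev u + 1 ∨ (N.lev w + 1 = N.lev u ∧ t = N.echo u + 1) ∨
      (N.lev w = N.lev u + 1 ∧ t = N.announce + N.lev u + 1) ∨
      (N.Owns u w ∧ N.sendStart u w < t ∧ t ≤ N.sendStart u w + N.chunks)) := by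
  unfold mail at h
  split_ifs at h with h1 h2 h3 h4 h5
  all_goals simp_all

lemma mail_first {u w : V} (h : N.graph.Adj u w) : N.mail ω (N.lev u + 1) u w = some [] := by
  rw [mail, if_neg (not_not.2 h), if_pos rfl]

lemma mail_echo {u w : V} (h : N.graph.Adj u w) (hl : N.lev w + 1 = N.lev u) :
    N.mail ω (N.echo u + 1) u w = some (encodePair (N.widthBelow u, N.degreeBelow u)) := by
  have := N.lev_add_two_le_echo u
  rw [mail, if_neg (not_not.2 h), if_neg (by omega), if_pos ⟨hl, rfl⟩]

lemma mail_announce {u w : V} (h : N.graph.Adj u w) (hl : N.lev w = N.lev u + 1) :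
    N.mail ω (N.announce + N.lev u + 1) u w
      = some (encodePair (N.width, N.degreeBelow N.root)) := by
  have := N.two_mul_lev_le_announce u
  rw [mail, if_neg (not_not.2 h), if_neg (by omega), if_neg (by omega), if_pos ⟨hl, rfl⟩]

lemma mail_chunk {u w : V} (h : N.graph.Adj u w) (ho : N.Owns u w) {k : ℕ} (hk : k < N.chunks) :
    N.mail ω (N.sendStart u w + 1 + k) u w = some (List.ofFn fun j : Fin N.width =>
      N.edgeBit ω (k * N.width + j) u w) := by
  have h1 := N.two_mul_lev_le_announce u
  have h2 := N.two_mul_announce_le_sendStart u w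
  have h3 := N.echo_le_announce u
  rw [mail, if_neg (not_not.2 h), if_neg (by omega), if_neg (by omega), if_neg (by omega),
    if_pos ⟨ho, by omega, by omega⟩]
  rw [show N.sendStart u w + 1 + k - 1 - N.sendStart u w = k by omega]

lemma _root_.Nat.sInf_eq_of_isLeast {P : ℕ → Prop} {a : ℕ} (h : P a) (h' : ∀ s, P s → a ≤ s) :
    sInf {s | P s} = a :=
  IsLeast.csInf_eq ⟨h, fun s hs => h' s hs⟩

/-! ### What a vertex knows -/

section Knowledge

variable (v : V) (n : ℕ)

lemma heard_iff {s i : ℕ} : (N.view ω v n).Heard s i ↔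
    s < n ∧ ∃ u, N.ident u = i ∧ (N.mail ω s u v).isSome := by
  change ((if s < n then Function.extend N.ident (fun u => N.mail ω s u v) (fun _ => none)
    else fun _ => none) i).isSome ↔ _
  by_cases hs : s < n
  · rw [if_pos hs]
    constructor
    · intro h
      refine ⟨hs, ?_⟩
      by_cases hi : ∃ u, N.ident u = i
      · obtain ⟨u, rfl⟩ := hi
        rw [N.ident_injective.extend_apply] at h
        exact ⟨u, rfl, h⟩
      · rw [Function.extend_apply' _ _ _ hi] at h
        simp at h
    · rintro ⟨-, u, rfl, h⟩
      rwa [N.ident_injective.extend_apply]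
  · rw [if_neg hs]
    simp [hs]

lemma heard_ident_iff {s : ℕ} {u : V} : (N.view ω v n).Heard s (N.ident u) ↔
    s < n ∧ (N.mail ω s u v).isSome := by
  rw [heard_iff]
  constructor
  · rintro ⟨h, w, hw, h'⟩
    exact ⟨h, N.ident_injective hw ▸ h'⟩
  · rintro ⟨h, h'⟩
    exact ⟨h, u, rfl, h'⟩

lemma inb_eq {s : ℕ} {u : V} (hs : s < n) :
    (N.view ω v n).inb s (N.ident u) = N.mail ω s u v := by
  change (if s < n then Function.extend N.ident (fun u => N.mail ω s u v) (fun _ => none)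
    else fun _ => none) _ = _
  rw [if_pos hs, N.ident_injective.extend_apply]

lemma lev_succ_le_of_mail {s : ℕ} {u w : V} (h : (N.mail ω s u w).isSome) : N.lev u + 1 ≤ s := by
  have h1 := (N.mail_isSome ω h).2
  have h2 := N.two_mul_lev_le_announce u
  have h3 := N.two_mul_announce_le_sendStart u w
  have h4 := N.lev_add_two_le_echo u
  omega

lemma lev_le_of_heard {s i : ℕ} (h : (N.view ω v n).Heard s i) : N.lev v ≤ s ∧ s < n := by
  obtain ⟨hs, u, rfl, hm⟩ := (N.heard_iff ω v n).1 h
  have h1 := N.lev_succ_le_of_mail ω hm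
  have h2 := N.lev_le_of_adj (N.mail_isSome ω hm).1
  omega

lemma leader_eq : (N.view ω v n).leader = decide (v = N.root) := rfl

lemma heard_par (hv : v ≠ N.root) (hn : N.lev v < n) :
    (N.view ω v n).Heard (N.lev v) (N.ident (N.par v)) := by
  have h := N.par_spec hv
  rw [heard_ident_iff]
  refine ⟨hn, ?_⟩
  rw [← h.2.1, N.mail_first ω h.1.symm]
  rfl

lemma awake_iff : (N.view ω v n).Awake ↔ v = N.root ∨ N.lev v < n := by
  rw [View.Awake, leader_eq, decide_eq_true_iff]
  by_cases hv : v = N.root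
  · simp [hv]
  · simp only [hv, false_or]
    constructor
    · rintro ⟨s, i, h⟩
      have := N.lev_le_of_heard ω v n h
      omega
    · intro h
      exact ⟨_, _, N.heard_par ω v n hv h⟩

variable {n}

lemma level_eq (hn : N.lev v < n) : (N.view ω v n).level = N.lev v := by
  rw [View.level, leader_eq]
  by_cases hv : v = N.root
  · simp [hv]
  · rw [if_neg (by simpa using hv)]
    refine Nat.sInf_eq_of_isLeast ⟨_, N.heard_par ω v n hv hn⟩ ?_
    rintro s ⟨i, h⟩
    exact (N.lev_le_of_heard ω v n h).1

variable {v}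

/-- A neighbour is at most one level deeper, so by round `lev v + 2` it has been heard. Without that
bound the set may be empty and `sInf` would return 0. -/
lemma first_eq (hn : N.lev v + 2 < n) {u : V} (hu : N.graph.Adj v u) :
    (N.view ω v n).first (N.ident u) = N.lev u + 1 := by
  refine Nat.sInf_eq_of_isLeast ?_ fun s hs => ?_
  · rw [heard_ident_iff, N.mail_first ω hu.symm]
    have := N.lev_le_of_adj hu
    exact ⟨by omega, rfl⟩
  · exact N.lev_succ_le_of_mail ω ((N.heard_ident_iff ω v n).1 hs).2

lemma le_of_second_mail_lower {u : V} (hu : N.lev u = N.lev v + 1) {s : ℕ}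
    (hs : N.lev u + 1 < s) (h : (N.mail ω s u v).isSome) : N.echo u + 1 ≤ s := by
  have h1 := (N.mail_isSome ω h).2
  have h2 := N.echo_le_announce u
  have h3 := N.two_mul_announce_le_sendStart u v
  omega

/-- The upper endpoint never owns the edge, so it sends no chunks downwards, and its second message
is the announcement. -/
lemma le_of_second_mail_upper {u : V} (hu : N.lev u + 1 = N.lev v) {s : ℕ}
    (hs : N.lev u + 1 < s) (h : (N.mail ω s u v).isSome) : N.announce + N.lev v ≤ s := by
  have h1 := (N.mail_isSome ω h).2
  have h2 : ¬ N.Owns u v := by unfold Owns; omega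
  have h3 : ¬ N.lev v + 1 = N.lev u := by omega
  simp only [h2, h3, false_and, or_false, false_or] at h1
  omega

lemma exists_second_lower_iff (hn : N.lev v + 2 < n) {u : V} (hu : u ∈ N.lower v) :
    (∃ s, (N.view ω v n).first (N.ident u) < s ∧ (N.view ω v n).Heard s (N.ident u)) ↔
      N.echo u + 1 < n := by
  rw [mem_lower] at hu
  simp only [N.first_eq ω hn hu.1, heard_ident_iff]
  constructor
  · rintro ⟨s, h1, h2, h3⟩
    have := N.le_of_second_mail_lower ω hu.2 h1 h3
    omega
  · intro h
    have := N.lev_add_two_le_echo u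
    exact ⟨N.echo u + 1, by omega, h, by rw [N.mail_echo ω hu.1.symm (by omega)]; rfl⟩

lemma second_lower (hn : N.lev v + 2 < n) {u : V} (hu : u ∈ N.lower v) (he : N.echo u + 1 < n) :
    (N.view ω v n).second (N.ident u) = N.echo u + 1 := by
  rw [mem_lower] at hu
  have := N.lev_add_two_le_echo u
  refine Nat.sInf_eq_of_isLeast ?_ ?_
  · rw [N.first_eq ω hn hu.1, heard_ident_iff, N.mail_echo ω hu.1.symm (by omega)]
    exact ⟨by omega, he, rfl⟩
  · rintro s ⟨h1, h2⟩
    rw [N.first_eq ω hn hu.1] at h1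
    exact N.le_of_second_mail_lower ω hu.2 h1 ((N.heard_ident_iff ω v n).1 h2).2

lemma content_lower (hn : N.lev v + 2 < n) {u : V} (hu : u ∈ N.lower v) (he : N.echo u + 1 < n) :
    (N.view ω v n).content (N.ident u) = (N.widthBelow u, N.degreeBelow u) := by
  rw [View.content, N.second_lower ω hn hu he, N.inb_eq ω v n he]
  rw [mem_lower] at hu
  rw [N.mail_echo ω hu.1.symm (by omega)]
  simp

lemma lower_eq (hn : N.lev v + 2 < n) :
    (N.view ω v n).lower = (N.lower v).image N.ident := by
  classical
  ext i
  simp only [View.lower, Finset.mem_filter, Finset.mem_image, mem_lower,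
    N.level_eq ω v (n := n) (by omega)]
  constructor
  · rintro ⟨h1, h2⟩
    obtain ⟨u, hu, rfl⟩ := Finset.mem_image.1 h1
    rw [SimpleGraph.mem_neighborFinset] at hu
    rw [N.first_eq ω hn hu] at h2
    exact ⟨u, ⟨hu, by omega⟩, rfl⟩
  · rintro ⟨u, ⟨h1, h2⟩, rfl⟩
    refine ⟨Finset.mem_image_of_mem _ (by rwa [SimpleGraph.mem_neighborFinset]), ?_⟩
    rw [N.first_eq ω hn h1]
    omega

lemma echo_succ_le_of_lower {u : V} (hu : u ∈ N.lower v) : N.echo u + 1 ≤ N.echo v := by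
  rw [N.echo_eq v]
  exact le_max_of_le_right (Finset.le_sup (f := fun u => N.echo u + 1) hu)

lemma ready_iff : (N.view ω v n).Ready ↔ N.echo v < n := by
  have h0 := N.lev_add_two_le_echo v
  constructor
  · rintro ⟨h1, h2, h3⟩
    have hv : N.lev v < n := by
      rcases (N.awake_iff ω v n).1 h1 with rfl | h
      · rw [lev_root]
        have : (N.view ω N.root n).rounds = n := rfl
        omega
      · exact h
    rw [N.level_eq ω v hv] at h2
    change N.lev v + 2 < n at h2
    rw [N.lower_eq ω h2] at h3
    rw [N.echo_eq v, max_lt_iff]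
    refine ⟨h2, (Finset.sup_lt_iff (by rw [Nat.bot_eq_zero]; omega)).2 fun u hu => ?_⟩
    exact (N.exists_second_lower_iff ω h2 hu).1 (h3 _ (Finset.mem_image_of_mem _ hu))
  · intro h
    have h2 : N.lev v + 2 < n := by omega
    refine ⟨(N.awake_iff ω v n).2 (Or.inr (by omega)), ?_, ?_⟩
    · rw [N.level_eq ω v (by omega)]
      exact h2
    · rw [N.lower_eq ω h2]
      intro i hi
      obtain ⟨u, hu, rfl⟩ := Finset.mem_image.1 hi
      rw [N.exists_second_lower_iff ω h2 hu]
      have := N.echo_succ_le_of_lower hu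
      omega

lemma echoTime_eq (hn : N.echo v < n) : (N.view ω v n).echoTime = N.echo v := by
  have h0 := N.lev_add_two_le_echo v
  rw [View.echoTime, N.level_eq ω v (by omega), N.lower_eq ω (by omega), N.echo_eq v,
    Finset.sup_image]
  congr 1
  refine Finset.sup_congr rfl fun u hu => ?_
  have := N.echo_succ_le_of_lower hu
  exact N.second_lower ω (by omega) hu (by omega)

lemma report_eq (hn : N.echo v < n) :
    (N.view ω v n).report = (N.widthBelow v, N.degreeBelow v) := by
  have h0 := N.lev_add_two_le_echo v
  have hc : ∀ u ∈ N.lower v, (N.view ω v n).content (N.ident u)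
      = (N.widthBelow u, N.degreeBelow u) := fun u hu => by
    have := N.echo_succ_le_of_lower hu
    exact N.content_lower ω (by omega) hu (by omega)
  rw [View.report, N.lower_eq ω (by omega), Finset.sup_image, Finset.sup_image, widthBelow,
    degreeBelow, sup_below, sup_below]
  refine Prod.ext ?_ ?_
  · change max _ _ = max _ _
    congr 1
    exact Finset.sup_congr rfl fun u hu => by rw [Function.comp, hc u hu]; rfl
  · change max _ _ = max _ _
    congr 1
    · change ((N.graph.neighborFinset v).image N.ident).card = _
      rw [Finset.card_image_of_injective _ N.ident_injective,
        SimpleGraph.card_neighborFinset_eq_degree]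
    · exact Finset.sup_congr rfl fun u hu => by rw [Function.comp, hc u hu]; rfl

lemma parentId_eq (hv : v ≠ N.root) (hn : N.lev v + 2 < n) :
    (N.view ω v n).parentId = N.ident (N.par v) := by
  rw [(N.par_spec hv).2.2, View.parentId, N.level_eq ω v (by omega)]
  congr 1
  ext i
  constructor
  · rintro ⟨h1, h2⟩
    obtain ⟨u, hu, rfl⟩ := Finset.mem_image.1 h1
    rw [SimpleGraph.mem_neighborFinset] at hu
    rw [N.first_eq ω hn hu] at h2
    exact ⟨u, hu, h2, rfl⟩
  · rintro ⟨u, h1, h2, rfl⟩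
    refine ⟨Finset.mem_image_of_mem _ (by rwa [SimpleGraph.mem_neighborFinset]), ?_⟩
    rw [N.first_eq ω hn h1, h2]

lemma mail_par (hv : v ≠ N.root) :
    N.mail ω (N.announce + N.lev v) (N.par v) v
      = some (encodePair (N.width, N.degreeBelow N.root)) := by
  have h := N.par_spec hv
  rw [← N.mail_announce ω h.1.symm h.2.1.symm, ← h.2.1, ← add_assoc]

lemma informed_iff : (N.view ω v n).Informed ↔ N.announce + N.lev v < n := by
  rw [View.Informed, leader_eq]
  by_cases hv : v = N.root
  · subst hv
    simp [ready_iff, echo_root]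
  · rw [if_neg (by simpa using hv), awake_iff]
    have h0 := N.two_mul_lev_le_announce v
    have hp := N.par_spec hv
    constructor
    · rintro ⟨h1, h2, s, h3, h4⟩
      have h1' := h1.resolve_left hv
      rw [N.level_eq ω v h1'] at h2
      change N.lev v + 2 < n at h2
      rw [N.parentId_eq ω hv h2] at h3 h4
      rw [N.first_eq ω h2 hp.1] at h3
      rw [heard_ident_iff] at h4
      have := N.le_of_second_mail_upper ω hp.2.1 h3 h4.2
      omega
    · intro h
      have h2 : N.lev v + 2 < n := by omega
      refine ⟨Or.inr (by omega), ?_, N.announce + N.lev v, ?_, ?_⟩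
      · rw [N.level_eq ω v (by omega)]; exact h2
      · rw [N.parentId_eq ω hv h2, N.first_eq ω h2 hp.1]; omega
      · rw [N.parentId_eq ω hv h2, heard_ident_iff, N.mail_par ω hv]
        exact ⟨h, rfl⟩

lemma second_parentId (hv : v ≠ N.root) (hn : N.announce + N.lev v < n) :
    (N.view ω v n).second (N.view ω v n).parentId = N.announce + N.lev v := by
  have h0 := N.two_mul_lev_le_announce v
  have hp := N.par_spec hv
  rw [N.parentId_eq ω hv (by omega)]
  refine Nat.sInf_eq_of_isLeast ?_ ?_
  · rw [N.first_eq ω (by omega) hp.1, heard_ident_iff, N.mail_par ω hv]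
    exact ⟨by omega, hn, rfl⟩
  · rintro s ⟨h1, h2⟩
    rw [N.first_eq ω (by omega) hp.1] at h1
    exact N.le_of_second_mail_upper ω hp.2.1 h1 ((N.heard_ident_iff ω v n).1 h2).2

/-- The announcement carries no time stamp. It descends one level per round, so arrival round minus
level is the same everywhere and serves as a common clock. -/
lemma announceTime_eq (hn : N.announce + N.lev v < n) :
    (N.view ω v n).announceTime = N.announce := by
  have h0 := N.two_mul_lev_le_announce v
  rw [View.announceTime, leader_eq]
  by_cases hv : v = N.root
  · subst hv
    rw [if_pos (by simp), N.echoTime_eq ω (by rw [echo_root]; omega), echo_root]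
  · rw [if_neg (by simpa using hv), N.second_parentId ω hv hn, N.level_eq ω v (by omega)]
    omega

lemma params_eq (hn : N.announce + N.lev v < n) :
    (N.view ω v n).params = (N.width, N.degreeBelow N.root) := by
  have h0 := N.two_mul_lev_le_announce v
  rw [View.params, leader_eq]
  by_cases hv : v = N.root
  · subst hv
    rw [if_pos (by simp), N.report_eq ω (by rw [echo_root]; omega)]
    rfl
  · rw [if_neg (by simpa using hv), View.content, N.second_parentId ω hv hn,
      N.parentId_eq ω hv (by omega), N.inb_eq ω v n hn, N.mail_par ω hv]
    simp

lemma chunks_eq (hn : N.announce + N.lev v < n) : (N.view ω v n).chunks = N.chunks := by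
  rw [View.chunks, N.params_eq ω hn]; rfl

lemma bits_eq (hn : N.announce + N.lev v < n) :
    (N.view ω v n).bits = N.chunks * N.width := by
  rw [View.bits, N.params_eq ω hn, N.chunks_eq ω hn]

end Knowledge

end Network

/-! ### Local computation of the circulation -/

namespace Network

variable {V : Type*} [Fintype V] [DecidableEq V] (N : Network V)
  (ω : DistributedAlgorithm.Coins V)

section Values

variable {v : V} {n : ℕ}

lemma owned_iff (hn : N.lev v + 2 < n) {w : V} (hw : N.graph.Adj v w) :
    (N.view ω v n).Owned (N.ident w) ↔ N.Owns v w := by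
  have := N.lev_le_of_adj hw
  have := N.lev_le_of_adj hw.symm
  rw [View.Owned, N.first_eq ω hn hw, N.level_eq ω v (by omega)]
  change N.lev w + 1 = N.lev v ∨ N.lev w + 1 = N.lev v + 1 ∧ N.ident w < N.ident v ↔ _
  unfold Owns
  omega

lemma sendStart_view_eq (hn : N.announce + N.lev v < n) {w : V} (hw : N.graph.Adj v w) :
    (N.view ω v n).sendStart (N.ident w) = N.sendStart v w := by
  have := N.two_mul_lev_le_announce v
  rw [View.sendStart, sendStart, N.first_eq ω (by omega) hw, N.level_eq ω v (by omega),
    N.announceTime_eq ω hn]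
  simp only [Nat.add_right_cancel_iff]

lemma arrivalStart_eq (hn : N.announce + N.lev v < n) {w : V} (hw : N.graph.Adj v w)
    (ho : N.Owns w v) : (N.view ω v n).arrivalStart (N.ident w) = N.sendStart w v + 1 := by
  have h0 := N.two_mul_lev_le_announce v
  have h1 := N.lev_le_of_adj hw
  rw [View.arrivalStart, sendStart, N.first_eq ω (by omega) hw, N.level_eq ω v (by omega),
    N.announceTime_eq ω hn]
  unfold Owns at ho
  split_ifs <;> omega

lemma div_width_lt {j : ℕ} (hj : j < N.chunks * N.width) :
    j / N.width < N.chunks ∧ 0 < N.width := by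
  have : 0 < N.width := Nat.pos_of_ne_zero fun h => by simp [h] at hj
  exact ⟨(Nat.div_lt_iff_lt_mul this).2 hj, this⟩

lemma received_eq (hn : N.announce + N.lev v < n) {w : V} (hw : N.graph.Adj v w)
    (ho : N.Owns w v) {j : ℕ} (hj : j < N.chunks * N.width)
    (ht : N.sendStart w v + 1 + j / N.width < n) :
    (N.view ω v n).received (N.ident w) j = N.edgeBit ω j w v := by
  obtain ⟨h1, h2⟩ := N.div_width_lt hj
  rw [View.received, N.arrivalStart_eq ω hn hw ho, N.params_eq ω hn, N.inb_eq ω v n ht,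
    N.mail_chunk ω hw.symm ho h1]
  have h3 : j % N.width < N.width := Nat.mod_lt _ h2
  rw [Option.getD_some, List.getD_eq_getElem?_getD, List.getElem?_eq_getElem (by simpa using h3)]
  simp only [Option.getD_some, List.getElem_ofFn]
  rw [Nat.div_add_mod']

/-- The number of coins ignores the recorded coins, which is why `view` can be built on `listen`
without circularity. -/
lemma coinCount_view (s : ℕ) : (N.listen ω v s).coinCount = (N.view ω v s).coinCount := rfl

/-- Coins are flipped in every round, but only those of round `2 * announce` are used. By then every
vertex knows the number of bits, so its coin count covers all the indices needed. -/
lemma coin_eq (hn : 2 * N.announce < n) {w : V} (hw : N.graph.Adj v w)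
    {j : ℕ} (hj : j < N.chunks * N.width) :
    (N.view ω v n).coin (2 * N.announce) (Nat.pair (N.ident w) j)
      = N.coinValue (2 * N.announce) ω j v w := by
  have h0 := N.two_mul_lev_le_announce v
  change (if 2 * N.announce < n ∧ Nat.pair (N.ident w) j <
    (N.listen ω v (2 * N.announce + 1)).coinCount then _ else _) = _
  rw [if_pos]
  · rfl
  · refine ⟨hn, ?_⟩
    rw [coinCount_view, View.coinCount, N.bits_eq ω (by omega), Nat.lt_succ_iff]
    refine Finset.le_sup (f := fun p : ℕ × ℕ => Nat.pair p.1 p.2) (b := (N.ident w, j)) ?_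
    rw [Finset.mem_product, Finset.mem_range]
    exact ⟨Finset.mem_image_of_mem _ (by rwa [SimpleGraph.mem_neighborFinset]), hj⟩

lemma offTree_of_free (hn : 2 * N.announce < n) {w : V} (hw : N.Free v w)
    {j : ℕ} (hj : j < N.chunks * N.width) :
    (N.view ω v n).offTree (N.ident w) j = N.edgeBit ω j v w := by
  have h0 := N.two_mul_lev_le_announce v
  rw [View.offTree, if_pos ((N.owned_iff ω (by omega) hw.1).2 hw.2.1),
    N.announceTime_eq ω (by omega), N.coin_eq ω hn hw.1 hj, edgeBit, N.flow_free _ hw]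

/-- The pipeline: chunk `k` from the next level arrives in round `3 * announce + 1 - lev v + k`.
Chunks from the same level start right after round `2 * announce` and are there by then. -/
lemma offTree_eq {j : ℕ} (hj : j < N.chunks * N.width)
    (hn : 3 * N.announce + 1 - N.lev v + j / N.width < n) {w : V}
    (hw : N.graph.Adj v w) (hp : w ≠ N.par v) :
    (N.view ω v n).offTree (N.ident w) j = N.edgeBit ω j v w := by
  have h0 := N.two_mul_lev_le_announce v
  have hn' := lt_of_le_of_lt (Nat.le_add_right _ _) hn
  by_cases ho : N.Owns v w
  · exact N.offTree_of_free ω (by omega) ⟨hw, ho, hp⟩ hj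
  · have ho' := (N.not_owns_iff hw).1 ho
    rw [View.offTree, if_neg (by rwa [N.owned_iff ω (by omega) hw]),
      N.received_eq ω (by omega) hw ho' hj]
    · exact (N.flow_symm _ hw).symm
    · have := N.lev_le_of_adj hw
      unfold sendStart
      unfold Owns at ho'
      split_ifs <;> omega

lemma root_not_owns {w : V} (h : N.graph.Adj N.root w) : ¬ N.Owns N.root w := by
  intro ho
  have : N.lev w = 0 := by
    have := N.lev_root
    unfold Owns at ho
    omega
  exact h.ne (N.lev_eq_zero.1 this).symm

/-- At the leader `parentId` is the default 0, possibly a genuine identifier. The conjunct `Owned`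
in `value` excludes this case, since the leader owns no edge. -/
lemma value_eq_offTree (hn : N.lev v + 2 < n) {w : V} (hw : N.graph.Adj v w)
    (hp : w ≠ N.par v) (j : ℕ) :
    (N.view ω v n).value (N.ident w) j = (N.view ω v n).offTree (N.ident w) j := by
  rw [View.value, if_neg]
  rintro ⟨h1, h2⟩
  rw [N.owned_iff ω hn hw] at h1
  have hv : v ≠ N.root := by
    rintro rfl
    exact N.root_not_owns hw h1
  rw [N.parentId_eq ω hv hn] at h2
  exact hp (N.ident_injective h2)

lemma value_eq {j : ℕ} (hj : j < N.chunks * N.width)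
    (hn : 3 * N.announce + 1 - N.lev v + j / N.width < n) {w : V} (hw : N.graph.Adj v w) :
    (N.view ω v n).value (N.ident w) j = N.edgeBit ω j v w := by
  have h0 := N.two_mul_lev_le_announce v
  have hn' := lt_of_le_of_lt (Nat.le_add_right _ _) hn
  by_cases hp : w = N.par v
  · have hv : v ≠ N.root := by
      rintro rfl
      rw [par_root] at hp
      exact hw.ne hp.symm
    subst hp
    rw [View.value, N.parentId_eq ω hv (by omega), if_pos
      ⟨(N.owned_iff ω (by omega) hw).2 (N.owns_par hv), rfl⟩, edgeBit, N.flow_par _ hv, up_eq]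
    change ∑ k ∈ ((N.graph.neighborFinset v).image N.ident).erase _, _ = _
    rw [← Finset.image_erase N.ident_injective, Finset.sum_image N.ident_injective.injOn]
    refine Finset.sum_congr rfl fun u hu => ?_
    rw [Finset.mem_erase, SimpleGraph.mem_neighborFinset] at hu
    exact N.offTree_eq ω hj hn hu.2 hu.1
  · rw [N.value_eq_offTree ω (by omega) hw hp, N.offTree_eq ω hj hn hw hp]

end Values

/-! ### Induction over the rounds -/

/-- What a vertex sends is what the closed form predicts. -/
lemma outbox_eq {v w : V} (hw : N.graph.Adj v w) {n : ℕ} (hn : 0 < n) :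
    (N.view ω v n).outbox (N.ident w) = N.mail ω n v w := by
  have h0 := N.two_mul_lev_le_announce v
  have he := N.lev_add_two_le_echo v
  have he' := N.echo_le_announce v
  have hs := N.two_mul_announce_le_sendStart v w
  by_cases h1 : N.lev v < n
  swap
  · have hA : ¬ (N.view ω v n).Awake := by
      rw [awake_iff]
      rintro (rfl | h)
      · rw [lev_root] at h1; omega
      · exact h1 h
    rw [View.outbox, if_pos hA]
    cases hm : N.mail ω n v w with
    | none => rfl
    | some m =>
      have := N.lev_succ_le_of_mail ω (show (N.mail ω n v w).isSome by rw [hm]; rfl)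
      omega
  have hA : (N.view ω v n).Awake := (N.awake_iff ω v n).2 (Or.inr h1)
  rw [View.outbox, if_neg (not_not.2 hA), N.level_eq ω v h1]
  have hr : (N.view ω v n).rounds = n := rfl
  rw [hr]
  by_cases h2 : n = N.lev v + 1
  · rw [if_pos h2, h2, N.mail_first ω hw]
  rw [if_neg h2, mail, if_neg (not_not.2 hw), if_neg h2, ready_iff, informed_iff]
  by_cases h3 : N.echo v < n
  swap
  · rw [if_neg (by omega), if_neg (by omega), if_neg (by omega), if_neg (by omega),
      if_neg (by omega), if_neg]
    rintro ⟨-, h4, -⟩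
    omega
  rw [N.echoTime_eq ω h3, N.report_eq ω h3, N.first_eq ω (by omega) hw]
  by_cases h4 : N.lev w + 1 = N.lev v ∧ n = N.echo v + 1
  · rw [if_pos ⟨h3, h4⟩, if_pos h4]
  rw [if_neg (fun h => h4 h.2), if_neg h4]
  by_cases h5 : N.announce + N.lev v < n
  swap
  · rw [if_neg (by omega), if_neg (by omega), if_neg (by omega), if_neg]
    rintro ⟨-, h6, -⟩
    omega
  rw [N.announceTime_eq ω h5, N.params_eq ω h5, N.chunks_eq ω h5,
    N.sendStart_view_eq ω h5 hw, N.owned_iff ω (by omega) hw]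
  by_cases h6 : N.lev w = N.lev v + 1 ∧ n = N.announce + N.lev v + 1
  · rw [if_pos (by omega), if_pos h6]
  rw [if_neg (by omega), if_neg h6]
  by_cases h7 : N.Owns v w ∧ N.sendStart v w < n ∧ n ≤ N.sendStart v w + N.chunks
  swap
  · rw [if_neg (fun h => h7 h.2), if_neg h7]
  rw [if_pos ⟨h5, h7⟩, if_pos h7]
  refine congrArg some (congrArg List.ofFn (funext fun j => ?_))
  change (N.view ω v n).value (N.ident w) ((n - 1 - N.sendStart v w) * N.width + j) = _
  have hk : n - 1 - N.sendStart v w < N.chunks := by omega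
  have hj : (n - 1 - N.sendStart v w) * N.width + j < N.chunks * N.width := by
    calc (n - 1 - N.sendStart v w) * N.width + j
        < (n - 1 - N.sendStart v w) * N.width + N.width := by have := j.2; omega
      _ = (n - 1 - N.sendStart v w + 1) * N.width := by ring
      _ ≤ N.chunks * N.width := Nat.mul_le_mul_right _ hk
  -- An owned edge within a level is free, so its bits are the sender's own coins. An owned edge
  -- going up may be the tree edge, whose chunk needs those that arrived from below in this very
  -- round.
  by_cases h8 : N.lev w = N.lev v
  · have hp : w ≠ N.par v := by
      rintro rfl
      have hv : v ≠ N.root := by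
        rintro rfl
        exact N.root_not_owns hw h7.1
      have := (N.par_spec hv).2.1
      omega
    rw [N.value_eq_offTree ω (by omega) hw hp, N.offTree_of_free ω (by omega) ⟨hw, h7.1, hp⟩ hj]
  · refine N.value_eq ω hj ?_ hw
    have h9 : ((n - 1 - N.sendStart v w) * N.width + j) / N.width = n - 1 - N.sendStart v w := by
      rw [mul_comm, Nat.mul_add_div (lt_of_le_of_lt (Nat.zero_le _) j.2),
        Nat.div_eq_of_lt j.2, add_zero]
    rw [h9]
    have h10 : N.sendStart v w = 3 * N.announce + 1 - N.lev v := if_neg h8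
    omega

/-- The number of rounds. -/
noncomputable def duration : ℕ := 3 * N.announce + N.chunks + 1

lemma done_iff (v : V) (n : ℕ) : (N.view ω v n).Done ↔ N.duration ≤ n := by
  have h0 := N.two_mul_lev_le_announce v
  rw [View.Done, informed_iff]
  constructor
  · rintro ⟨h1, h2⟩
    rw [N.announceTime_eq ω h1, N.chunks_eq ω h1] at h2
    exact h2
  · intro h
    have h1 : N.announce + N.lev v < n := by unfold duration at h; omega
    rw [N.announceTime_eq ω h1, N.chunks_eq ω h1]
    exact ⟨h1, h⟩

lemma receive_view (v : V) (t : ℕ) :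
    (N.view ω v t).receive
      (Function.extend N.ident (fun u => N.mail ω t u v) (fun _ => none))
      = { N.listen ω v (t + 1) with coin := (N.view ω v t).coin } := by
  simp only [View.receive, view, listen, View.mk.injEq, true_and, and_true]
  funext s
  by_cases hs : s = t
  · subst hs
    rw [Function.update_self, if_pos (Nat.lt_succ_self _)]
  · rw [Function.update_of_ne hs]
    by_cases h : s < t
    · rw [if_pos h, if_pos (by omega)]
    · rw [if_neg h, if_neg (by omega)]

lemma record_receive_view (v : V) (t : ℕ) :
    let u := (N.view ω v t).receive
      (Function.extend N.ident (fun u => N.mail ω t u v) (fun _ => none))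
    u.record t u.coinCount (fun i => ω (v, t, i)) = N.view ω v (t + 1) := by
  intro u
  have hu : u = { N.listen ω v (t + 1) with coin := (N.view ω v t).coin } := N.receive_view ω v t
  have hc : u.coinCount = (N.listen ω v (t + 1)).coinCount := by rw [hu]; rfl
  rw [hc, hu]
  simp only [View.record, view, View.mk.injEq, true_and]
  funext s i
  by_cases hs : s = t
  · subst hs
    rw [Function.update_self]
    by_cases h : i < (N.listen ω v (s + 1)).coinCount
    · rw [dif_pos h, if_pos ⟨Nat.lt_succ_self _, h⟩]
    · rw [dif_neg h, if_neg fun h' => h h'.2]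
  · rw [Function.update_of_ne hs]
    have : s < t ↔ s < t + 1 := by omega
    simp only [this]

/-- The execution of the algorithm in closed form. -/
lemma run_eq {t : ℕ} (ht : t ≤ N.duration) :
    cutVertexAlgorithm.run N.graph N.ident N.root ω t
      = { state := fun v => N.view ω v t, sent := N.mail ω t } := by
  induction t with
  | zero =>
    simp only [DistributedAlgorithm.run]
    congr 1
    funext u w
    cases hm : N.mail ω 0 u w with
    | none => rfl
    | some m =>
      have := N.lev_succ_le_of_mail ω (show (N.mail ω 0 u w).isSome by rw [hm]; rfl)
      omega
  | succ t ih =>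
    have hact : ∀ v, cutVertexAlgorithm.act N.ident ω t
        { state := fun v => N.view ω v t, sent := N.mail ω t } v
        = (N.view ω v (t + 1), (N.view ω v (t + 1)).outbox) := by
      intro v
      have ho : (N.view ω v t).output = none := by
        rw [View.output, if_neg]
        rw [done_iff]
        omega
      rw [DistributedAlgorithm.act, if_neg]
      · change ((_ : View), View.outbox _) = _
        rw [← N.record_receive_view ω v t]
        rfl
      · change ¬ ((N.view ω v t).output).isSome = true
        rw [ho]
        simp
    simp only [DistributedAlgorithm.run]
    rw [ih (by omega)]
    simp only [hact]
    congr 1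
    funext u w
    by_cases h : N.graph.Adj u w
    · rw [if_pos h, N.outbox_eq ω h (Nat.succ_pos t)]
    · rw [if_neg h, mail, if_pos h]

lemma output_isSome (v : V) : ((N.view ω v N.duration).output).isSome := by
  rw [View.output, if_pos ((N.done_iff ω v _).2 le_rfl)]
  rfl

lemma state_eq_of_duration_le {t : ℕ} (ht : N.duration ≤ t) (v : V) :
    (cutVertexAlgorithm.run N.graph N.ident N.root ω t).state v = N.view ω v N.duration := by
  induction t, ht using Nat.le_induction with
  | base => rw [N.run_eq ω le_rfl]
  | succ t ht ih =>
    simp only [DistributedAlgorithm.run, DistributedAlgorithm.act]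
    rw [if_pos, ih]
    rw [ih]
    exact N.output_isSome ω v

lemma sent_eq_none {t : ℕ} (ht : N.duration < t) (u w : V) :
    (cutVertexAlgorithm.run N.graph N.ident N.root ω t).sent u w = none := by
  obtain ⟨t, rfl⟩ : ∃ s, t = s + 1 := ⟨t - 1, by omega⟩
  simp only [DistributedAlgorithm.run, DistributedAlgorithm.act]
  rw [if_pos (c := ((cutVertexAlgorithm.output
    ((cutVertexAlgorithm.run N.graph N.ident N.root ω t).state u)).isSome = true))]
  · split_ifs <;> rfl
  · rw [N.state_eq_of_duration_le ω (by omega)]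
    exact N.output_isSome ω u

lemma mail_of_sent {t : ℕ} {u w : V} {m : Message}
    (h : (cutVertexAlgorithm.run N.graph N.ident N.root ω t).sent u w = some m) :
    N.mail ω t u w = some m := by
  by_cases ht : t ≤ N.duration
  · rw [N.run_eq ω ht] at h
    exact h
  · rw [N.sent_eq_none ω (by omega)] at h
    exact absurd h (by simp)

lemma output_eq (v : V) : ∃ b : Bool, (N.view ω v N.duration).output = some b ∧
    (b = true ↔ ∃ Y ⊆ N.graph.neighborFinset v, Y.Nonempty ∧ Y ≠ N.graph.neighborFinset v ∧
      ∀ j < N.chunks * N.width, ∑ w ∈ Y, N.edgeBit ω j v w = 0) := by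
  classical
  have h0 := N.two_mul_lev_le_announce v
  have hval : ∀ j < N.chunks * N.width, ∀ Y ⊆ N.graph.neighborFinset v,
      ∑ i ∈ Y.image N.ident, (N.view ω v N.duration).value i j = ∑ w ∈ Y, N.edgeBit ω j v w := by
    intro j hj Y hY
    rw [Finset.sum_image N.ident_injective.injOn]
    refine Finset.sum_congr rfl fun w hw => N.value_eq ω hj ?_ ?_
    · have := (N.div_width_lt hj).1
      unfold duration
      omega
    · have := hY hw
      rwa [SimpleGraph.mem_neighborFinset] at this
  rw [View.output, if_pos ((N.done_iff ω v _).2 le_rfl)]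
  refine ⟨_, rfl, ?_⟩
  rw [decide_eq_true_iff, N.bits_eq ω (by unfold duration; omega)]
  change (∃ Y ⊆ (N.graph.neighborFinset v).image N.ident, Y.Nonempty ∧
    Y ≠ (N.graph.neighborFinset v).image N.ident ∧ _) ↔ _
  constructor
  · rintro ⟨Z, h1, h2, h3, h4⟩
    obtain ⟨Y, hY, rfl⟩ := Finset.subset_image_iff.1 h1
    have hY' : Y ⊆ N.graph.neighborFinset v := by exact_mod_cast hY
    refine ⟨Y, hY', by simpa using h2, fun h => h3 (by rw [h]), fun j hj => ?_⟩
    rw [← hval j hj Y hY', h4 j hj]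
  · rintro ⟨Y, h1, h2, h3, h4⟩
    refine ⟨Y.image N.ident, Finset.image_subset_image h1, h2.image _,
      fun h => h3 (Finset.image_injective N.ident_injective h), fun j hj => ?_⟩
    rw [hval j hj Y h1, h4 j hj]

end Network

/-! ### Time, message and size bounds -/

namespace Network

variable {V : Type*} [Fintype V] [DecidableEq V] (N : Network V)
  (ω : DistributedAlgorithm.Coins V)

lemma degreeBelow_root : N.degreeBelow N.root = N.graph.maxDegree := by
  apply le_antisymm
  · exact Finset.sup_le fun u _ => N.graph.degree_le_maxDegree u
  · refine N.graph.maxDegree_le_of_forall_degree_le _ fun u => ?_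
    exact Finset.le_sup (f := fun u => N.graph.degree u) (by rw [below_root]; exact Finset.mem_univ u)

lemma size_le_width (v : V) : (N.ident v).size ≤ N.width :=
  Finset.le_sup (f := fun u => (N.ident u).size) (by rw [below_root]; exact Finset.mem_univ v)

lemma exists_width_eq : ∃ v, N.width = (N.ident v).size := by
  obtain ⟨v, -, h⟩ := Finset.exists_mem_eq_sup _ ⟨_, N.self_mem_below N.root⟩
    fun u => (N.ident u).size
  exact ⟨v, h⟩

/-- Distinct identifiers of at most `width` bits are at most `2 ^ width` in number; this lets
`width` stand in for the unknown logarithm. -/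
lemma card_le_two_pow_width : Fintype.card V ≤ 2 ^ N.width := by
  have h : (Finset.univ.image N.ident) ⊆ Finset.range (2 ^ N.width) := by
    intro i hi
    obtain ⟨v, -, rfl⟩ := Finset.mem_image.1 hi
    exact Finset.mem_range.2 (Nat.size_le.1 (N.size_le_width v))
  have := Finset.card_le_card h
  rwa [Finset.card_image_of_injective _ N.ident_injective, Finset.card_range,
    Finset.card_univ] at this

lemma width_pos : 0 < N.width := by
  by_contra h
  have h1 := N.card_le_two_pow_width
  have h2 := N.two_le_card
  rw [show N.width = 0 by omega] at h1
  omega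

/-- Of the three extra chunks, one makes up for rounding down in the division and two supply the
summand `2 * width`. -/
lemma maxDegree_add_le : N.graph.maxDegree + 2 * N.width ≤ N.chunks * N.width := by
  have h1 := Nat.div_add_mod N.graph.maxDegree N.width
  have h2 := Nat.mod_lt N.graph.maxDegree N.width_pos
  rw [chunks, degreeBelow_root, add_mul, mul_comm (_ / _)]
  omega

lemma one_le_logb_card (N : Network V) : 1 ≤ Real.logb 2 (Fintype.card V) := by
  have h := N.two_le_card
  rw [Real.le_logb_iff_rpow_le one_lt_two (by exact_mod_cast (by omega : 0 < Fintype.card V)),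
    Real.rpow_one]
  exact_mod_cast h

lemma logb_card_le_width : Real.logb 2 (Fintype.card V) ≤ N.width := by
  have h0 : 0 < Fintype.card V := by have := N.two_le_card; omega
  rw [Real.logb_le_iff_le_rpow one_lt_two (by exact_mod_cast h0), Real.rpow_natCast]
  exact_mod_cast N.card_le_two_pow_width

lemma chunks_le :
    (N.chunks : ℝ) ≤ N.graph.maxDegree / Real.logb 2 (Fintype.card V) + 3 := by
  have h1 := N.one_le_logb_card
  have h2 := N.logb_card_le_width
  rw [chunks, degreeBelow_root]
  push_cast
  gcongr
  refine Nat.cast_div_le.trans ?_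
  gcongr

lemma one_le_diam : 1 ≤ N.graph.diam := by
  have : Nontrivial V := Fintype.one_lt_card_iff_nontrivial.1 N.two_le_card
  exact Nat.one_le_iff_ne_zero.2 (SimpleGraph.connected_iff_diam_ne_zero.1 N.connected)

lemma height_root_le_diam : N.height N.root ≤ N.graph.diam := by
  have : Nonempty V := ⟨N.root⟩
  exact Finset.sup_le fun u _ =>
    SimpleGraph.dist_le_diam (SimpleGraph.connected_iff_ediam_ne_top.1 N.connected)

/-- The duration is at most `6 * height + 10` plus the quotient of degree by logarithm; the 10 is
absorbed because the diameter is at least 1. -/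
lemma duration_le : (N.duration : ℝ) ≤
    16 * (N.graph.diam + N.graph.maxDegree / Real.logb 2 (Fintype.card V)) := by
  have h1 := N.chunks_le
  have h2 : (N.height N.root : ℝ) ≤ N.graph.diam := by exact_mod_cast N.height_root_le_diam
  have h3 : (1 : ℝ) ≤ N.graph.diam := by exact_mod_cast N.one_le_diam
  have h4 := N.one_le_logb_card
  have h5 : 0 ≤ (N.graph.maxDegree : ℝ) / Real.logb 2 (Fintype.card V) := by positivity
  rw [duration, announce]
  push_cast
  linarith

lemma size_maxDegree_le :
    (N.graph.maxDegree.size : ℝ) ≤ Real.logb 2 (Fintype.card V) + 1 := by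
  have h0 := N.one_le_logb_card
  by_cases h : N.graph.maxDegree.size = 0
  · rw [h]
    push_cast
    linarith
  have h1 : 2 ^ (N.graph.maxDegree.size - 1) ≤ N.graph.maxDegree := Nat.lt_size.1 (by omega)
  have : Nonempty V := ⟨N.root⟩
  have h2 : N.graph.maxDegree < Fintype.card V := N.graph.maxDegree_lt_card_verts
  have h3 : ((N.graph.maxDegree.size - 1 : ℕ) : ℝ) ≤ Real.logb 2 (Fintype.card V) := by
    rw [Real.le_logb_iff_rpow_le one_lt_two (by exact_mod_cast (by omega : 0 < Fintype.card V)),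
      Real.rpow_natCast]
    exact_mod_cast h1.trans h2.le
  rw [Nat.cast_sub (by omega)] at h3
  push_cast at h3
  linarith

lemma length_mail_le {t : ℕ} {u w : V} {m : Message} (h : N.mail ω t u w = some m) :
    m.length ≤ N.width + 1 + N.graph.maxDegree.size := by
  have hw : N.widthBelow u ≤ N.width := N.sup_below_le _ u
  have hd : N.degreeBelow u ≤ N.graph.maxDegree := by
    rw [← degreeBelow_root]; exact N.sup_below_le _ u
  have hd' := Nat.size_le_size hd
  unfold mail at h
  split_ifs at h
  · rw [← Option.some.inj h]
    simp
  · rw [← Option.some.inj h, length_encodePair]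
    change N.widthBelow u + 1 + (N.degreeBelow u).size ≤ _
    omega
  · rw [← Option.some.inj h, length_encodePair, degreeBelow_root]
  · rw [← Option.some.inj h, List.length_ofFn]
    omega

/-- In each direction an edge carries at most a wake-up call, an echo, an announcement and the
chunks. -/
lemma card_mail_le (T : ℕ) (u w : V) :
    ((Finset.range T).filter fun t => (N.mail ω (t + 1) u w).isSome).card
      ≤ if N.graph.Adj u w then 3 + N.chunks else 0 := by
  split_ifs with h
  · have hsub : ((Finset.range T).filter fun t => (N.mail ω (t + 1) u w).isSome) ⊆
        {N.lev u, N.echo u, N.announce + N.lev u} ∪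
          Finset.Ico (N.sendStart u w) (N.sendStart u w + N.chunks) := by
      intro t ht
      have := (N.mail_isSome ω (Finset.mem_filter.1 ht).2).2
      simp only [Finset.mem_union, Finset.mem_insert, Finset.mem_singleton, Finset.mem_Ico]
      omega
    refine (Finset.card_le_card hsub).trans ((Finset.card_union_le _ _).trans ?_)
    rw [Nat.card_Ico, Nat.add_sub_cancel_left]
    exact Nat.add_le_add_right Finset.card_le_three _
  · rw [Nat.le_zero, Finset.card_eq_zero, Finset.filter_eq_empty_iff]
    intro t _ hm
    exact h (N.mail_isSome ω hm).1

lemma messageCount_le :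
    cutVertexAlgorithm.messageCount N.graph N.ident N.root ω N.duration
      ≤ 2 * N.graph.edgeFinset.card * (3 + N.chunks) := by
  have h1 : ∀ t ∈ Finset.range N.duration, (Finset.univ.filter fun p : V × V =>
      ((cutVertexAlgorithm.run N.graph N.ident N.root ω (t + 1)).sent p.1 p.2).isSome).card
      = ∑ p : V × V, if (N.mail ω (t + 1) p.1 p.2).isSome then 1 else 0 := by
    intro t ht
    rw [N.run_eq ω (Finset.mem_range.1 ht), Finset.card_filter]
  rw [DistributedAlgorithm.messageCount, Finset.sum_congr rfl h1, Finset.sum_comm]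
  calc ∑ p : V × V, ∑ t ∈ Finset.range N.duration,
        (if (N.mail ω (t + 1) p.1 p.2).isSome then 1 else 0)
      ≤ ∑ p : V × V, if N.graph.Adj p.1 p.2 then 3 + N.chunks else 0 := by
        refine Finset.sum_le_sum fun p _ => ?_
        rw [← Finset.card_filter]
        exact N.card_mail_le ω _ _ _
    _ = ∑ u, ∑ w, if N.graph.Adj u w then 3 + N.chunks else 0 := Fintype.sum_prod_type _
    _ = ∑ u, N.graph.degree u * (3 + N.chunks) := by
        refine Finset.sum_congr rfl fun u _ => ?_
        rw [← Finset.sum_filter, Finset.sum_const, smul_eq_mul,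
          ← SimpleGraph.neighborFinset_eq_filter, SimpleGraph.card_neighborFinset_eq_degree]
    _ = 2 * N.graph.edgeFinset.card * (3 + N.chunks) := by
        rw [← Finset.sum_mul, SimpleGraph.sum_degrees_eq_twice_card_edges]

lemma messageCount_le_real :
    (cutVertexAlgorithm.messageCount N.graph N.ident N.root ω N.duration : ℝ) ≤
      16 * (N.graph.edgeFinset.card *
        (1 + N.graph.maxDegree / Real.logb 2 (Fintype.card V))) := by
  have h1 : (cutVertexAlgorithm.messageCount N.graph N.ident N.root ω N.duration : ℝ)
      ≤ 2 * N.graph.edgeFinset.card * (3 + N.chunks) := by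
    exact_mod_cast N.messageCount_le ω
  have h2 := N.chunks_le
  have h4 := N.one_le_logb_card
  have h5 : 0 ≤ (N.graph.maxDegree : ℝ) / Real.logb 2 (Fintype.card V) := by positivity
  calc _ ≤ _ := h1
    _ ≤ 2 * N.graph.edgeFinset.card *
          (8 * (1 + N.graph.maxDegree / Real.logb 2 (Fintype.card V))) := by
        gcongr
        linarith
    _ = _ := by ring

lemma messagesBoundedBy {c : ℝ}
    (hc : ∀ v, ((N.ident v).size : ℝ) ≤ c * Real.logb 2 (Fintype.card V)) :
    cutVertexAlgorithm.MessagesBoundedBy N.graph N.ident N.root ω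
      ((16 + |c|) * Real.logb 2 (Fintype.card V)) := by
  intro t u w m hm
  have h1 : (m.length : ℝ) ≤ N.width + 1 + N.graph.maxDegree.size := by
    exact_mod_cast N.length_mail_le ω (N.mail_of_sent ω hm)
  obtain ⟨v, hv⟩ := N.exists_width_eq
  have h2 : (N.width : ℝ) ≤ |c| * Real.logb 2 (Fintype.card V) := by
    rw [hv]
    have h3 := N.one_le_logb_card
    exact (hc v).trans (by gcongr; exact le_abs_self c)
  have h3 := N.size_maxDegree_le
  have h4 := N.one_le_logb_card
  linarith

lemma haltsWithin :
    cutVertexAlgorithm.HaltsWithin N.graph N.ident N.root ω N.duration := by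
  intro v
  rw [N.run_eq ω le_rfl]
  exact N.output_isSome ω v

lemma le_measureReal_findsCutVertices :
    1 - 1 / (Fintype.card V : ℝ) ≤ (DistributedAlgorithm.coinMeasure V).real
      {ω | cutVertexAlgorithm.FindsCutVertices N.graph N.ident N.root ω N.duration} := by
  have : MeasureTheory.IsProbabilityMeasure (DistributedAlgorithm.coinMeasure V) := by
    unfold DistributedAlgorithm.coinMeasure; infer_instance
  refine (N.measureReal_flow_detects (2 * N.announce) (N.chunks * N.width) N.width
    N.card_le_two_pow_width N.maxDegree_add_le).trans (MeasureTheory.measureReal_mono ?_)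
  intro ω hω v
  rw [N.run_eq ω le_rfl]
  obtain ⟨b, h1, h2⟩ := N.output_eq ω v
  exact ⟨b, h1, h2.trans (hω v)⟩

end Network

theorem mainTheorem8 :
    ∃ A : DistributedAlgorithm, ∀ c : ℝ, ∃ C : ℝ,
      ∀ (V : Type*) [Fintype V] [DecidableEq V] (G : SimpleGraph V) [DecidableRel G.Adj]
        (ident : V → ℕ) (r : V),
        G.Connected → 2 ≤ Fintype.card V → Function.Injective ident →
        (∀ v, ((ident v).size : ℝ) ≤ c * Real.logb 2 (Fintype.card V)) →
        ∃ T : ℕ,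
          (T : ℝ) ≤ C * (G.diam + G.maxDegree / Real.logb 2 (Fintype.card V)) ∧
          (∀ ω : DistributedAlgorithm.Coins V,
            A.HaltsWithin G ident r ω T ∧
            (A.messageCount G ident r ω T : ℝ) ≤
              C * (G.edgeFinset.card * (1 + G.maxDegree / Real.logb 2 (Fintype.card V))) ∧
            A.MessagesBoundedBy G ident r ω (C * Real.logb 2 (Fintype.card V))) ∧
          1 - 1 / (Fintype.card V : ℝ) ≤
            (DistributedAlgorithm.coinMeasure V).real
              {ω | A.FindsCutVertices G ident r ω T} := by
  -- Time and message count need only the 16; `|c|` enters through the identifier size in the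
  -- message length.
  refine ⟨cutVertexAlgorithm, fun c => ⟨16 + |c|, ?_⟩⟩
  intro V _ _ G _ ident r hG hV hinj hc
  let N : Network V := ⟨G, inferInstance, ident, r, hG, hV, hinj⟩
  have hlog := N.one_le_logb_card
  have habs := abs_nonneg c
  refine ⟨N.duration, N.duration_le.trans ?_, fun ω => ⟨N.haltsWithin ω,
    (N.messageCount_le_real ω).trans ?_, N.messagesBoundedBy ω hc⟩,
    N.le_measureReal_findsCutVertices⟩
  · change 16 * ((G.diam : ℝ) + G.maxDegree / Real.logb 2 (Fintype.card V)) ≤ _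
    gcongr
    linarith
  · change 16 * ((G.edgeFinset.card : ℝ) *
      (1 + G.maxDegree / Real.logb 2 (Fintype.card V))) ≤ _
    gcongr
    linarith
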